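/- For a finite group $G$, a sequence is a finite tuple of elements of $G$ (repetition allowed), a subsequence is obtained by keeping the terms at a nonempty set of positions, and a product-one subsequence is a subsequence whose terms have product $1$ when multiplied in some order. Let $d(G)$ be the smallest positive integer $m$ such that every sequence of length $m$ in $G$ has a product-one subsequence, and let $f(G)$ be the smallest positive integer $m$ such that every sequence of length $d(G)$ in $G$ has a product-one subsequence of length at most $m$. Theorem. Let $p$ be a prime, let $n>1$ be an integer, and let $g$ be an integer whose multiplicative order modulo $n$ is $p$. Let $$G=\mathbb{Z}_p\ltimes_g\mathbb{Z}_n=\langle x,y \mid x^n=y^p=1,\ x^g y=yx\rangle .$$ Then $d(G)=n+p-1$ and $f(G)=n$. -/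

import Mathlib

namespace ProductOne

/-- `Π(S)`: the set of all products of the terms of the sequence `S`, taken in any order. -/
def productSet {G : Type*} [Group G] (S : List G) : Set G :=
  {a | ∃ L : List G, L.Perm S ∧ L.prod = a}

/-- `S` is a product-one sequence: its terms multiply to `1` in some order. -/
def IsProductOne {G : Type*} [Group G] (S : List G) : Prop :=
  (1 : G) ∈ productSet S

/-- `T` is a product-one subsequence of `S`; subsequences are nonempty. -/
def IsProductOneSubsequence {G : Type*} [Group G] (T S : List G) : Prop :=
  T ≠ [] ∧ T.Sublist S ∧ IsProductOne T

/-- The Davenport constant `d(G)`: the smallest positive integer `m` such that every sequence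
of length `m` has a product-one subsequence. (The set is nonempty for every finite group; the
value would be `0` if there were no such `m`.) -/
noncomputable def davenport (G : Type*) [Group G] : ℕ :=
  sInf {m : ℕ | 0 < m ∧ ∀ S : List G, S.length = m → ∃ T : List G, IsProductOneSubsequence T S}

/-- The constant `f(G)`: the smallest positive integer `m` such that every sequence of length
`d(G)` has a product-one subsequence of length at most `m`. -/
noncomputable def fConstant (G : Type*) [Group G] : ℕ :=
  sInf {m : ℕ | 0 < m ∧ ∀ S : List G, S.length = davenport G →
    ∃ T : List G, IsProductOneSubsequence T S ∧ T.length ≤ m}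

/-- The relators of `⟨x, y | x ^ b = y ^ a = 1, x ^ g * y = y * x⟩`, with `x = of 0`, `y = of 1`. -/
def metacyclicRels (a b : ℕ) (g : ℤ) : Set (FreeGroup (Fin 2)) :=
  {FreeGroup.of 0 ^ b, FreeGroup.of 1 ^ a,
    FreeGroup.of 0 ^ g * FreeGroup.of 1 * (FreeGroup.of 1 * FreeGroup.of 0)⁻¹}

/-- The metacyclic group `ℤ_a ⋉_g ℤ_b = ⟨x, y | x ^ b = y ^ a = 1, x ^ g * y = y * x⟩`
(to be used when `g` has multiplicative order `a` modulo `b`). -/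
abbrev MetacyclicGroup (a b : ℕ) (g : ℤ) : Type :=
  PresentedGroup (metacyclicRels a b g)

end ProductOne

/-!
The metacyclic group has a cyclic normal subgroup `X = ⟨x⟩` of order `n` and prime index `p`, and
it is not abelian. These properties alone imply that every sequence of length `n + p - 1` has a
product-one subsequence of length at most `n`
(`hasShortProductOne_of_isCyclic_of_index_prime`). The lower bounds come from the sequence of
copies of `x` followed by `p - 1` copies of `y`: a product-one subsequence contains no `y`, so it
has at least `n` terms.

The main tool is the set `subProducts` of those elements of an abelian group `C`, mapped to `G`,
that are products of nonempty subsequences in some order. By the Kemperman–Scherk theorem its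
size is superadditive in the sequence as long as no product equals `1`
(`ncard_subProducts_add`). So disjoint subsequences whose numbers of products in `C` add up to
`|C|` contain a product-one subsequence.

If some subgroup `N ≤ X` of prime order has a nonabelian quotient, then induction applied to
`G ⧸ N` yields `|N|` disjoint subsequences of length at most `n / |N|` with a product in `N`, and
this suffices. Otherwise the commutator subgroup is the only subgroup of `X` of prime order, and
there are two cases.

* If the centre is not trivial, then it has order `n / p`, and its quotient is elementary abelian
  of order `p ^ 2`. In that quotient `3 * p - 2` terms always contain a zero-sum of length at most
  `p`, by the Chevalley–Warning theorem, and such zero-sums are extracted greedily. At the end it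
  can happen that only a longer minimal zero-sum is left, but it contains noncommuting terms and so
  has two products (`hasShortProductOne_of_ker_eq_center`).
* If the centre is trivial, then `n` is prime and `X` is the kernel of a Frobenius group. Cyclic
  rotations show that a minimal sequence of length `k` with a product in `X` has at least `k`
  products, so exactly `n` terms with a product in `X` suffice. They exist by Cauchy–Davenport in
  `G ⧸ X`, unless more than `n` terms lie in one coset of `X`. In the latter case,
  Cauchy–Davenport in `X` shows that the products of `p` terms of that coset cover all nontrivial
  elements of `X` (`hasShortProductOne_of_frobenius`).
-/

namespace ProductOne

open scoped Pointwise

/-! ### Products of multisets and their subproducts -/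

/-- The set of products of the terms of the multiset `S`, taken in any order. -/
def orderedProducts {G : Type*} [Group G] (S : Multiset G) : Set G :=
  {a | ∃ L : List G, (L : Multiset G) = S ∧ L.prod = a}

/-- `S` contains a nonempty product-one subsequence of length at most `l`. -/
def HasShortProductOne {G : Type*} [Group G] (S : Multiset G) (l : ℕ) : Prop :=
  ∃ T ≤ S, T ≠ 0 ∧ T.card ≤ l ∧ (1 : G) ∈ orderedProducts T

/-- The elements of `C` whose image under `f` is an ordered product of a nonempty
submultiset of `S`. The homomorphism `f` is usually the inclusion of an abelian subgroup. -/
def subProducts {G C : Type*} [Group G] [Group C] (f : C →* G) (S : Multiset G) : Set C :=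
  {c | ∃ T ≤ S, T ≠ 0 ∧ f c ∈ orderedProducts T}

section basic

variable {G Q C : Type*} [Group G] [Group Q] [Group C]

lemma mul_mem_orderedProducts {S T : Multiset G} {a b : G} (ha : a ∈ orderedProducts S)
    (hb : b ∈ orderedProducts T) : a * b ∈ orderedProducts (S + T) := by
  obtain ⟨L, rfl, rfl⟩ := ha
  obtain ⟨M, rfl, rfl⟩ := hb
  exact ⟨L ++ M, by simp, by simp⟩

lemma orderedProducts_nonempty (S : Multiset G) : (orderedProducts S).Nonempty := by
  induction S using Quotient.inductionOn with
  | h L => exact ⟨L.prod, L, rfl, rfl⟩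

lemma map_mem_orderedProducts (f : G →* Q) {S : Multiset G} {a : G}
    (ha : a ∈ orderedProducts S) : f a ∈ orderedProducts (S.map f) := by
  obtain ⟨L, rfl, rfl⟩ := ha
  exact ⟨L.map f, by simp, by simp [map_list_prod]⟩

lemma exists_mem_orderedProducts_of_map (f : G →* Q) {S : Multiset G} {b : Q}
    (hb : b ∈ orderedProducts (S.map f)) : ∃ a ∈ orderedProducts S, f a = b := by
  obtain ⟨L, hL, rfl⟩ := hb
  have : ∃ M : List G, (M : Multiset G) = S ∧ M.map f = L := by
    classical
    induction L generalizing S with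
    | nil => exact ⟨[], by simpa [eq_comm] using hL, rfl⟩
    | cons b L ih =>
      obtain ⟨a, ha, rfl, h⟩ := (Multiset.map_eq_cons _ _ _ _).2
        (hL.symm.trans (Multiset.cons_coe b L).symm)
      obtain ⟨M, hM, rfl⟩ := ih h.symm
      exact ⟨a :: M, by rw [← Multiset.cons_coe, hM, Multiset.cons_erase ha], rfl⟩
  obtain ⟨M, hM, rfl⟩ := this
  exact ⟨M.prod, ⟨M, hM, rfl⟩, by simp [map_list_prod]⟩

lemma exists_le_map_eq {α β : Type*} (f : α → β) {S : Multiset α} {T : Multiset β}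
    (h : T ≤ S.map f) : ∃ U ≤ S, U.map f = T := by
  induction S using Quotient.inductionOn with
  | h K =>
    induction T using Quotient.inductionOn with
    | h L =>
      have h' : List.Subperm L (K.map f) := by simpa using h
      obtain ⟨M, hM, hM'⟩ := h'
      obtain ⟨N, hN, rfl⟩ := List.sublist_map_iff.1 hM'
      exact ⟨N, by simpa using hN.subperm, by simpa using hM⟩

lemma orderedProducts_eq_singleton {A : Type*} [CommGroup A] (S : Multiset A) :
    orderedProducts S = {S.prod} := by
  ext a
  constructor
  · rintro ⟨L, rfl, rfl⟩
    simp
  · rintro rfl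
    obtain ⟨a, L, rfl, rfl⟩ := orderedProducts_nonempty S
    exact ⟨L, rfl, by simp⟩

lemma HasShortProductOne.mono {S T : Multiset G} {k l : ℕ} (h : HasShortProductOne S k)
    (hST : S ≤ T) (hkl : k ≤ l) : HasShortProductOne T l := by
  obtain ⟨U, h1, h2, h3, h4⟩ := h
  exact ⟨U, h1.trans hST, h2, h3.trans hkl, h4⟩

lemma subProducts_mono (f : C →* G) {S T : Multiset G} (h : S ≤ T) :
    subProducts f S ⊆ subProducts f T := fun _ ⟨U, h1, h2⟩ ↦ ⟨U, h1.trans h, h2⟩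

lemma one_mem_subProducts_iff {f : C →* G} {S : Multiset G} :
    1 ∈ subProducts f S ↔ HasShortProductOne S S.card := by
  constructor
  · rintro ⟨T, h1, h2, h3⟩
    exact ⟨T, h1, h2, Multiset.card_le_card h1, by simpa using h3⟩
  · rintro ⟨T, h1, h2, -, h3⟩
    exact ⟨T, h1, h2, by simpa using h3⟩

lemma one_notMem_subProducts {f : C →* G} {S T : Multiset G} {l : ℕ}
    (h : ¬ HasShortProductOne S l) (hT : T ≤ S) (hl : T.card ≤ l) : 1 ∉ subProducts f T :=
  fun h' ↦ h ((one_mem_subProducts_iff.1 h').mono hT hl)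

lemma mul_mem_subProducts {f : C →* G} {S T : Multiset G} {a b : C}
    (ha : a ∈ subProducts f S) (hb : b ∈ subProducts f T) : a * b ∈ subProducts f (S + T) := by
  obtain ⟨U, h1, h2, h3⟩ := ha
  obtain ⟨V, h4, -, h5⟩ := hb
  refine ⟨U + V, add_le_add h1 h4, ?_, ?_⟩
  · simp [h2]
  · rw [map_mul]
    exact mul_mem_orderedProducts h3 h5

end basic

/-! ### Superadditivity of the number of subproducts -/

/-- The Kemperman–Scherk theorem in an abelian group. The induction replaces the pair `(A, B)`
by a Dyson `e`-transform, which keeps the unique factorization of `1` and shrinks `B`. -/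
lemma card_add_card_le_card_mul_add_one {A : Type*} [CommGroup A] [DecidableEq A]
    (s t : Finset A) (hs : 1 ∈ s) (ht : 1 ∈ t)
    (h : ∀ a ∈ s, ∀ b ∈ t, a * b = 1 → a = 1 ∧ b = 1) :
    s.card + t.card ≤ (s * t).card + 1 := by
  induction hn : t.card using Nat.strong_induction_on generalizing s t with
  | _ n ih =>
    subst hn
    by_cases ht1 : t = {1}
    · subst ht1
      simp
    · obtain ⟨b, hb, hb1⟩ : ∃ b ∈ t, b ≠ 1 := by
        by_contra! hcon
        exact ht1 (Finset.eq_singleton_iff_unique_mem.2 ⟨ht, hcon⟩)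
      obtain ⟨e, he, hbe⟩ : ∃ e ∈ s, b * e ∉ s := by
        by_contra! hcon
        have hsub : s.image (b * ·) = s :=
          Finset.eq_of_subset_of_card_le (Finset.image_subset_iff.2 hcon)
            (by rw [Finset.card_image_of_injective _ (mul_right_injective b)])
        obtain ⟨a, ha, hab⟩ := Finset.mem_image.1 (hsub ▸ hs)
        exact hb1 (h a ha b hb (by rw [mul_comm]; exact hab)).2
      set x := Finset.mulDysonETransform e (s, t) with hx
      have hx1 : x.1 = s ∪ e • t := rfl
      have hx2 : x.2 = t ∩ e⁻¹ • s := rfl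
      have hcard := Finset.mulDysonETransform.card e (s, t)
      have hsub := Finset.mulDysonETransform.subset e (s, t)
      have hlt : x.2.card < t.card := by
        refine Finset.card_lt_card ?_
        rw [hx2]
        refine Finset.ssubset_iff_subset_ne.2 ⟨Finset.inter_subset_left, fun heq ↦ ?_⟩
        have hb' := Finset.inter_eq_left.1 heq hb
        rw [Finset.mem_inv_smul_finset_iff, smul_eq_mul, mul_comm] at hb'
        exact hbe hb'
      have key := ih x.2.card hlt x.1 x.2 (by rw [hx1]; exact Finset.mem_union_left _ hs)
        (by
          rw [hx2, Finset.mem_inter, Finset.mem_inv_smul_finset_iff]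
          exact ⟨ht, by simpa using he⟩)
        (by
          intro a ha c hc hac
          rw [hx2, Finset.mem_inter, Finset.mem_inv_smul_finset_iff, smul_eq_mul] at hc
          rw [hx1, Finset.mem_union] at ha
          rcases ha with ha | ha
          · exact h a ha c hc.1 hac
          · obtain ⟨d, hd, rfl⟩ := Finset.mem_smul_finset.1 ha
            rw [smul_eq_mul] at hac ⊢
            have h1 := h (e * c) hc.2 d hd (by rw [← hac]; ac_rfl)
            have h2 := h e he c hc.1 h1.1
            simp [h1.2, h2.1, h2.2]) rfl
      have h3 := Finset.card_le_card hsub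
      simp only [← hx] at hcard h3
      lia

lemma ncard_subProducts_lt {G C : Type*} [Group G] [Group C] [Finite C] {f : C →* G}
    {S : Multiset G} (h : 1 ∉ subProducts f S) :
    (subProducts f S).ncard < Nat.card C := by
  rw [← Set.ncard_univ]
  exact Set.ncard_lt_ncard (Set.ssubset_univ_iff.2 fun h' ↦ h (h' ▸ Set.mem_univ _))

section superadditive

variable {G C : Type*} [Group G] [Group C] [IsMulCommutative C] [Finite C] {f : C →* G}

/-- The number of subproducts is superadditive on sequences without a product-one
subsequence. -/
lemma ncard_subProducts_add {S T : Multiset G} (h : 1 ∉ subProducts f (S + T)) :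
    (subProducts f S).ncard + (subProducts f T).ncard ≤ (subProducts f (S + T)).ncard := by
  classical
  have := Fintype.ofFinite C
  let : CommGroup C := { ‹Group C› with mul_comm := mul_comm' }
  have hS : 1 ∉ subProducts f S := fun h' ↦ h (subProducts_mono f (Multiset.le_add_right S T) h')
  have hT : 1 ∉ subProducts f T := fun h' ↦ h (subProducts_mono f (Multiset.le_add_left T S) h')
  rw [Set.ncard_eq_toFinset_card', Set.ncard_eq_toFinset_card', Set.ncard_eq_toFinset_card']
  have key := card_add_card_le_card_mul_add_one (insert 1 (subProducts f S).toFinset)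
    (insert 1 (subProducts f T).toFinset) (by simp) (by simp) (by
      intro a ha b hb hab
      simp only [Finset.mem_insert, Set.mem_toFinset] at ha hb
      rcases ha with rfl | ha
      · exact ⟨rfl, by simpa using hab⟩
      rcases hb with rfl | hb
      · exact ⟨by simpa using hab, rfl⟩
      · exact absurd (hab ▸ mul_mem_subProducts ha hb) h)
  have hsub : insert 1 (subProducts f S).toFinset * insert 1 (subProducts f T).toFinset ⊆
      insert 1 (subProducts f (S + T)).toFinset := by
    intro c hc
    obtain ⟨a, ha, b, hb, rfl⟩ := Finset.mem_mul.1 hc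
    simp only [Finset.mem_insert, Set.mem_toFinset] at ha hb ⊢
    rcases ha with rfl | ha
    · rcases hb with rfl | hb
      · simp
      · exact Or.inr (subProducts_mono f (Multiset.le_add_left T S) (by simpa using hb))
    · rcases hb with rfl | hb
      · exact Or.inr (subProducts_mono f (Multiset.le_add_right S T) (by simpa using ha))
      · exact Or.inr (mul_mem_subProducts ha hb)
  have h2 := Finset.card_le_card hsub
  rw [Finset.card_insert_of_notMem (by simpa using hS),
    Finset.card_insert_of_notMem (by simpa using hT)] at key
  rw [Finset.card_insert_of_notMem (by simpa using h)] at h2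
  lia

/-- If every long sequence contains a short subsequence with a product in `C`, then `r` disjoint
such subsequences can be extracted, and together they have at least `r` subproducts. -/
lemma exists_le_ncard_subProducts {k l : ℕ} {S : Multiset G}
    (hk : ∀ U ≤ S, k ≤ U.card → ∃ T ≤ U, T.card ≤ l ∧ (subProducts f T).Nonempty) (r : ℕ)
    (hS : k + r * l ≤ S.card + l)
    (hfree : ∀ T ≤ S, T.card ≤ r * l → 1 ∉ subProducts f T) :
    ∃ T ≤ S, T.card ≤ r * l ∧ r ≤ (subProducts f T).ncard := by
  classical
  induction r with
  | zero => exact ⟨0, by simp, by simp, by simp⟩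
  | succ r ih =>
    rw [add_mul, one_mul] at hS hfree
    obtain ⟨T, hT, hTc, hTr⟩ := ih (by lia) fun T h1 h2 ↦ hfree T h1 (by lia)
    obtain ⟨U, hU, hUc, hUne⟩ := hk (S - T) tsub_le_self (by rw [Multiset.card_sub hT]; lia)
    have hle : T + U ≤ S := by
      calc T + U ≤ T + (S - T) := by gcongr
        _ = S := add_tsub_cancel_of_le hT
    have hc : (T + U).card ≤ (r + 1) * l := by
      rw [Multiset.card_add, add_mul, one_mul]; lia
    refine ⟨T + U, hle, hc, ?_⟩
    have h1 := ncard_subProducts_add (hfree (T + U) hle (by rwa [add_mul, one_mul] at hc))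
    have h2 := (Set.ncard_pos (Set.toFinite _)).2 hUne
    lia

end superadditive

/-! ### Set partitions and the Cauchy–Davenport theorem -/

/-- A sequence of length at least `k` without terms of multiplicity larger than `k` is the union
of `k` nonempty sets. -/
lemma exists_setPartition {α : Type*} [DecidableEq α] (k : ℕ) {S : Multiset α}
    (hk : k ≤ S.card) (hS : ∀ a, S.count a ≤ k) :
    ∃ L : List (Finset α), L.length = k ∧ (∀ C ∈ L, C.Nonempty) ∧
      (L.map Finset.val).sum = S := by
  induction k generalizing S with
  | zero =>
    refine ⟨[], rfl, by simp, ?_⟩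
    ext a
    exact (Nat.le_zero.1 (hS a)).symm
  | succ k ih =>
    -- The first set collects the terms of multiplicity `k + 1`, or any single term.
    obtain ⟨C, hC, hCle, hCc, hcount⟩ : ∃ C : Finset α, C.Nonempty ∧ C.val ≤ S ∧
        k + C.card ≤ S.card ∧ ∀ a, S.count a = k + 1 → a ∈ C := by
      by_cases h : ∃ a, S.count a = k + 1
      · obtain ⟨a, ha⟩ := h
        have hmem : ∀ b, b ∈ S.toFinset.filter (fun b ↦ S.count b = k + 1) ↔
            S.count b = k + 1 := by
          intro b
          simp only [Finset.mem_filter, Multiset.mem_toFinset, and_iff_right_iff_imp]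
          intro hb
          exact Multiset.count_pos.1 (by lia)
        refine ⟨S.toFinset.filter fun b ↦ S.count b = k + 1, ⟨a, (hmem a).2 ha⟩, ?_, ?_,
          fun b hb ↦ (hmem b).2 hb⟩
        · refine (Multiset.le_iff_subset (Finset.nodup _)).2 fun b hb ↦ ?_
          exact Multiset.mem_toFinset.1 (Finset.mem_filter.1 hb).1
        · set C := S.toFinset.filter fun b ↦ S.count b = k + 1
          have h1 : C.card * (k + 1) ≤ S.card := by
            rw [← Multiset.toFinset_sum_count_eq, ← smul_eq_mul, ← Finset.sum_const]
            calc ∑ _ ∈ C, (k + 1) = ∑ b ∈ C, S.count b :=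
                  Finset.sum_congr rfl fun b hb ↦ ((hmem b).1 hb).symm
              _ ≤ _ := Finset.sum_le_sum_of_subset (Finset.filter_subset _ _)
          have h2 : 1 ≤ C.card := Finset.card_pos.2 ⟨a, (hmem a).2 ha⟩
          nlinarith
      · push Not at h
        obtain ⟨a, ha⟩ := Multiset.card_pos_iff_exists_mem.1 (show 0 < S.card by lia)
        exact ⟨{a}, by simp, by simpa using ha, by simpa using hk, fun b hb ↦ absurd hb (h b)⟩
    obtain ⟨L, hL, hLne, hLs⟩ := ih (S := S - C.val) (by
        rw [Multiset.card_sub hCle]; simp only [Finset.card_val]; lia) (by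
        intro a
        rw [Multiset.count_sub]
        by_cases ha : S.count a = k + 1
        · have := Multiset.count_pos.2 (show a ∈ C.val from hcount a ha)
          lia
        · have := hS a
          lia)
    refine ⟨C :: L, by simp [hL], by simpa using ⟨hC, hLne⟩, ?_⟩
    simp only [List.map_cons, List.sum_cons, hLs]
    exact add_tsub_cancel_of_le hCle

section cauchyDavenport

variable {G Q : Type*} [Group G] [Group Q] {q : ℕ} {π : G →* Q}

/-- The Cauchy–Davenport theorem for two subsets of cosets of a normal subgroup of prime order,
given as the kernel of `π`. -/
lemma min_le_card_mul_of_ker [DecidableEq G] (hq : q.Prime) (hker : Nat.card π.ker = q)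
    {A B : Finset G} (hA : A.Nonempty) (hB : B.Nonempty) {c d : Q}
    (hAc : ∀ a ∈ A, π a = c) (hBd : ∀ b ∈ B, π b = d) :
    min q (A.card + B.card - 1) ≤ (A * B).card := by
  obtain ⟨a₀, ha₀⟩ := hA
  obtain ⟨b₀, hb₀⟩ := hB
  let s : Finset π.ker := A.attach.image fun a ↦
    ⟨a₀⁻¹ * a.1, by rw [MonoidHom.mem_ker, map_mul, map_inv, hAc _ ha₀, hAc _ a.2]; simp⟩
  let t : Finset π.ker := B.attach.image fun b ↦
    ⟨b.1 * b₀⁻¹, by rw [MonoidHom.mem_ker, map_mul, map_inv, hBd _ hb₀, hBd _ b.2]; simp⟩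
  have hs : s.card = A.card := by
    rw [Finset.card_image_of_injective _ (fun x y h ↦
      Subtype.ext (mul_left_cancel (congrArg Subtype.val h))), Finset.card_attach]
  have ht : t.card = B.card := by
    rw [Finset.card_image_of_injective _ (fun x y h ↦
      Subtype.ext (mul_right_cancel (congrArg Subtype.val h))), Finset.card_attach]
  have hmin : (q : ℕ∞) ≤ Monoid.minOrder π.ker := by
    rw [Monoid.le_minOrder]
    intro a ha _
    have := Fact.mk hq
    rw [orderOf_eq_prime (p := q) (by rw [← hker]; exact pow_card_eq_one') ha]
  have hcd := cauchy_davenport_minOrder_mul (s := s) (t := t)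
    (Finset.card_pos.1 (hs ▸ Finset.card_pos.2 ⟨a₀, ha₀⟩))
    (Finset.card_pos.1 (ht ▸ Finset.card_pos.2 ⟨b₀, hb₀⟩))
  have hle : (s * t).card ≤ (A * B).card := by
    refine Finset.card_le_card_of_injOn (fun h ↦ a₀ * h.1 * b₀) ?_ ?_
    · intro h hh
      obtain ⟨x, hx, y, hy, rfl⟩ := Finset.mem_mul.1 hh
      obtain ⟨a, -, rfl⟩ := Finset.mem_image.1 hx
      obtain ⟨b, -, rfl⟩ := Finset.mem_image.1 hy
      refine Finset.mem_mul.2 ⟨a.1, a.2, b.1, b.2, ?_⟩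
      simp [mul_assoc]
    · intro x _ y _ hxy
      exact Subtype.ext (mul_left_cancel (mul_right_cancel hxy))
  rw [hs, ht] at hcd
  have h1 := (min_le_min_right _ hmin).trans hcd
  have h2 : ((min q (A.card + B.card - 1) : ℕ) : ℕ∞) ≤ ((s * t).card : ℕ∞) := by
    exact h1
  exact (Nat.cast_le.1 h2).trans hle

lemma map_eq_pow_of_mem_list_prod [DecidableEq G] (L : List (Finset G)) {c : Q}
    (hc : ∀ C ∈ L, ∀ a ∈ C, π a = c) : ∀ a ∈ L.prod, π a = c ^ L.length := by
  induction L with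
  | nil => simp
  | cons A L ih =>
    intro x hx
    rw [List.prod_cons] at hx
    obtain ⟨a, ha, b, hb, rfl⟩ := Finset.mem_mul.1 hx
    rw [map_mul, hc A (by simp) a ha, ih (fun C hC ↦ hc C (by simp [hC])) b hb,
      List.length_cons, pow_succ']

lemma min_le_card_list_prod [DecidableEq G] (hq : q.Prime) (hker : Nat.card π.ker = q)
    (L : List (Finset G)) (hL : ∀ C ∈ L, C.Nonempty) {c : Q} (hc : ∀ C ∈ L, ∀ a ∈ C, π a = c) :
    min q ((L.map Finset.card).sum + 1 - L.length) ≤ L.prod.card := by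
  induction L with
  | nil => simp
  | cons A L ih =>
    have ih' := ih (fun C hC ↦ hL C (by simp [hC])) (fun C hC ↦ hc C (by simp [hC]))
    have hlen : L.length ≤ (L.map Finset.card).sum := by
      have := List.length_le_sum_of_one_le (L.map Finset.card) (by
        intro i hi
        obtain ⟨C, hC, rfl⟩ := List.mem_map.1 hi
        exact Finset.card_pos.2 (hL C (by simp [hC])))
      simpa using this
    have hne : L.prod.Nonempty := by
      rw [← Finset.card_pos]
      refine lt_of_lt_of_le (lt_min hq.pos ?_) ih'
      lia
    have h := min_le_card_mul_of_ker hq hker (hL A (by simp)) hne (hc A (by simp))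
      (map_eq_pow_of_mem_list_prod L fun C hC ↦ hc C (by simp [hC]))
    have hA : 1 ≤ A.card := Finset.card_pos.2 (hL A (by simp))
    simp only [List.map_cons, List.sum_cons, List.length_cons, List.prod_cons]
    refine le_trans ?_ h
    grind

lemma exists_mem_orderedProducts_of_mem_list_prod [DecidableEq G] (L : List (Finset G)) {a : G}
    (ha : a ∈ L.prod) :
    ∃ T ≤ (L.map Finset.val).sum, T.card = L.length ∧ a ∈ orderedProducts T := by
  induction L generalizing a with
  | nil => exact ⟨0, by simp, by simp, [], by simp, by simpa [eq_comm] using ha⟩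
  | cons A L ih =>
    rw [List.prod_cons] at ha
    obtain ⟨x, hx, y, hy, rfl⟩ := Finset.mem_mul.1 ha
    obtain ⟨T, hT, hTc, hTy⟩ := ih hy
    refine ⟨{x} + T, ?_, by simp [hTc, add_comm], mul_mem_orderedProducts ⟨[x], by simp⟩ hTy⟩
    rw [List.map_cons, List.sum_cons]
    exact add_le_add (by simpa using hx) hT

/-- A sequence in one coset of a normal subgroup of prime order `q`, with all multiplicities at
most `k`, has many products of exactly `k` terms. -/
lemma min_le_ncard_products_of_card_eq [Finite G] (hq : q.Prime) (hker : Nat.card π.ker = q)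
    {S : Multiset G} {c : Q} (hc : ∀ a ∈ S, π a = c) {k : ℕ} (hk : k ≤ S.card)
    (hS : ∀ a, ¬ Multiset.replicate (k + 1) a ≤ S) :
    min q (S.card + 1 - k) ≤
      {a : G | ∃ T ≤ S, T.card = k ∧ a ∈ orderedProducts T}.ncard := by
  classical
  obtain ⟨L, rfl, hLne, rfl⟩ := exists_setPartition k hk (by
    intro a
    by_contra! h
    exact hS a (Multiset.le_count_iff_replicate_le.1 h))
  have hmem : ∀ C ∈ L, ∀ a ∈ C, a ∈ (L.map Finset.val).sum := fun C hC a ha ↦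
    Multiset.mem_of_le (List.single_le_sum (by simp) _ (List.mem_map_of_mem hC)) ha
  have hcard : ((L.map Finset.val).sum).card = (L.map Finset.card).sum := by
    clear hk hS hc hmem hLne
    induction L with
    | nil => simp
    | cons A L ih => simp [ih]
  rw [hcard]
  refine (min_le_card_list_prod hq hker L hLne fun C hC a ha ↦ hc a (hmem C hC a ha)).trans ?_
  rw [← Set.ncard_coe_finset]
  exact Set.ncard_le_ncard (fun a ha ↦ exists_mem_orderedProducts_of_mem_list_prod L ha)
    (Set.toFinite _)

end cauchyDavenport

/-! ### Zero-sum subsequences in elementary abelian groups -/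

lemma exists_le_card_eq {α : Type*} {S : Multiset α} {k : ℕ} (h : k ≤ S.card) :
    ∃ T ≤ S, T.card = k := by
  induction S using Quotient.inductionOn with
  | h L =>
    refine ⟨(L.take k : List α), (List.take_sublist k L).subperm, ?_⟩
    simpa using h

/-- Olson's theorem for elementary abelian groups, by the Chevalley–Warning theorem applied to
the polynomials `∑ i, a i j * X i ^ (p - 1)`: the set of nonvanishing coordinates of a nontrivial
common zero is a zero-sum set. -/
lemma exists_nonempty_sum_eq_zero {p : ℕ} [Fact p.Prime] {ι κ : Type*} [Fintype ι] [Fintype κ]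
    (a : ι → κ → ZMod p) (h : Fintype.card κ * (p - 1) < Fintype.card ι) :
    ∃ s : Finset ι, s.Nonempty ∧ ∑ i ∈ s, a i = 0 := by
  classical
  have hp1 : p - 1 ≠ 0 := by have := (Fact.out : p.Prime).two_le; lia
  let F : κ → MvPolynomial ι (ZMod p) := fun j ↦ ∑ i, a i j • MvPolynomial.X i ^ (p - 1)
  have hdeg : ∑ j, (F j).totalDegree < Fintype.card ι := by
    refine lt_of_le_of_lt ?_ h
    rw [← Finset.card_univ, ← smul_eq_mul, ← Finset.sum_const]
    refine Finset.sum_le_sum fun j _ ↦ MvPolynomial.totalDegree_finsetSum_le fun i _ ↦ ?_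
    exact (MvPolynomial.totalDegree_smul_le _ _).trans (MvPolynomial.totalDegree_X_pow _ _).le
  have heval : ∀ (x : ι → ZMod p) (j : κ), MvPolynomial.eval x (F j) =
      ∑ i ∈ Finset.univ.filter (fun i ↦ x i ≠ 0), a i j := by
    intro x j
    simp [F, ZMod.pow_card_sub_one, Finset.sum_filter]
  have hdvd := char_dvd_card_solutions_of_fintype_sum_lt p hdeg
  let z : {x : ι → ZMod p // ∀ j, MvPolynomial.eval x (F j) = 0} :=
    ⟨0, fun j ↦ by rw [heval]; simp⟩
  obtain ⟨x, hx⟩ := Fintype.exists_ne_of_one_lt_card ((Fact.out : p.Prime).one_lt.trans_le <|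
    Nat.le_of_dvd (Fintype.card_pos_iff.2 ⟨z⟩) hdvd) z
  refine ⟨Finset.univ.filter (fun i ↦ x.1 i ≠ 0), ?_, ?_⟩
  · rw [← Subtype.coe_ne_coe, Function.ne_iff] at hx
    obtain ⟨i, hi⟩ := hx
    exact ⟨i, by simpa [z] using hi⟩
  · ext j
    rw [Finset.sum_apply, ← heval, x.2 j]
    rfl

lemma sum_map_apply {α κ M : Type*} [AddCommMonoid M] (a : α → κ → M) (S : Multiset α) (j : κ) :
    (S.map a).sum j = (S.map fun v ↦ a v j).sum := by
  induction S using Multiset.induction with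
  | empty => simp
  | cons v S ih => simp [ih]

lemma exists_le_sum_eq_zero {p : ℕ} [Fact p.Prime] {κ α : Type*} [Fintype κ]
    (a : α → κ → ZMod p) {S : Multiset α} (h : Fintype.card κ * (p - 1) < S.card) :
    ∃ T ≤ S, T ≠ 0 ∧ (T.map a).sum = 0 := by
  induction S using Quotient.inductionOn with
  | h L =>
    obtain ⟨s, hs, hsum⟩ := exists_nonempty_sum_eq_zero (fun i : Fin L.length ↦ a (L.get i))
      (by simpa using h)
    have hle : s.val.map L.get ≤ (L : Multiset α) := by
      calc s.val.map L.get ≤ Finset.univ.val.map L.get :=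
            Multiset.map_le_map (Finset.val_le_iff.2 (Finset.subset_univ s))
        _ = L := by
          rw [Fin.univ_val_map]
          simp
    refine ⟨s.val.map L.get, hle, ?_, ?_⟩
    · simpa [Finset.nonempty_iff_ne_empty] using hs
    · rw [Multiset.map_map]
      exact hsum

section rankTwo

variable {V : Type*} [CommGroup V] {p : ℕ} [Fact p.Prime]

/-- Coordinates on an elementary abelian group of rank two, as an additive map that detects
products equal to `1`. -/
lemma exists_coordinates_of_card_sq (hV : Nat.card V = p ^ 2) (hexp : ∀ v : V, v ^ p = 1) :
    ∃ e : V → Fin 2 → ZMod p, (∀ S : Multiset V, (S.map e).sum = 0 ↔ S.prod = 1) := by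
  have hp : p.Prime := Fact.out
  let : Module (ZMod p) (Additive V) := AddCommGroup.zmodModule (n := p) fun x ↦ hexp x.toMul
  have : Finite V := Nat.finite_of_card_ne_zero (by rw [hV]; exact pow_ne_zero 2 hp.ne_zero)
  have : Finite (Additive V) := inferInstanceAs (Finite V)
  have hrank : Module.finrank (ZMod p) (Additive V) = 2 := by
    have h := Module.natCard_eq_pow_finrank (K := ZMod p) (V := Additive V)
    rw [Nat.card_zmod, show Nat.card (Additive V) = p ^ 2 from hV] at h
    exact (Nat.pow_right_injective hp.two_le h).symm
  let e := (Module.finBasisOfFinrankEq (ZMod p) (Additive V) hrank).equivFun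
  refine ⟨fun v ↦ e (Additive.ofMul v), fun S ↦ ?_⟩
  have h1 : (S.map fun v ↦ e (Additive.ofMul v)).sum = e (Additive.ofMul S.prod) := by
    induction S using Multiset.induction with
    | empty => simp
    | cons v S ih => simp [ih]
  rw [h1, map_eq_zero_iff e e.injective]
  rfl

lemma exists_le_prod_eq_one_of_card_sq (hV : Nat.card V = p ^ 2) (hexp : ∀ v : V, v ^ p = 1)
    {S : Multiset V} (hS : 2 * p - 1 ≤ S.card) : ∃ T ≤ S, T ≠ 0 ∧ T.prod = 1 := by
  have := (Fact.out : p.Prime).two_le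
  obtain ⟨e, he⟩ := exists_coordinates_of_card_sq hV hexp
  obtain ⟨T, h1, h2, h3⟩ := exists_le_sum_eq_zero e (S := S) (by simp; lia)
  exact ⟨T, h1, h2, (he T).1 h3⟩

/-- A sequence of length `3 * p - 2` in an elementary abelian group of rank two has a zero-sum
subsequence of length at most `p`. An extra coordinate constantly equal to `1` yields one of
length `p` or `2 * p`, and in the second case it splits. -/
lemma exists_short_le_prod_eq_one_of_card_sq (hV : Nat.card V = p ^ 2)
    (hexp : ∀ v : V, v ^ p = 1) {S : Multiset V} (hS : 3 * p - 2 ≤ S.card) :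
    ∃ T ≤ S, T ≠ 0 ∧ T.card ≤ p ∧ T.prod = 1 := by
  classical
  have hp2 := (Fact.out : p.Prime).two_le
  obtain ⟨S', hS'le, hS'⟩ := exists_le_card_eq hS
  obtain ⟨e, he⟩ := exists_coordinates_of_card_sq hV hexp
  obtain ⟨T, hT, hT0, hTsum⟩ := exists_le_sum_eq_zero (κ := Option (Fin 2))
    (fun v j ↦ j.elim (1 : ZMod p) (e v)) (S := S') (by simp; lia)
  have hcoord : ∀ j : Option (Fin 2),
      (T.map fun v ↦ j.elim (1 : ZMod p) (e v)).sum = 0 := by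
    intro j
    have h := congrFun hTsum j
    rw [sum_map_apply] at h
    exact h
  have hdvd : p ∣ T.card := by
    have h := hcoord none
    simp only [Option.elim_none, Multiset.map_const', Multiset.sum_replicate, nsmul_eq_mul,
      mul_one] at h
    exact (CharP.cast_eq_zero_iff (ZMod p) p _).1 h
  have hprod : T.prod = 1 := by
    rw [← he]
    ext i
    rw [sum_map_apply]
    exact hcoord (some i)
  have hTc := Multiset.card_le_card hT
  have hTpos := Multiset.card_pos.2 hT0
  by_cases hTp : T.card ≤ p
  · exact ⟨T, hT.trans hS'le, hT0, hTp, hprod⟩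
  · have hT2 : T.card = 2 * p := by
      obtain ⟨k, hk⟩ := hdvd
      have h1 : k < 3 := by
        by_contra! h
        have := Nat.mul_le_mul_left p h
        lia
      interval_cases k <;> lia
    obtain ⟨T', hT', hT'c⟩ := exists_le_card_eq (show 2 * p - 1 ≤ T.card by lia)
    obtain ⟨U, hU, hU0, hUprod⟩ := exists_le_prod_eq_one_of_card_sq hV hexp hT'c.ge
    have hUT := hU.trans hT'
    have hUc := Multiset.card_le_card hU
    by_cases hUp : U.card ≤ p
    · exact ⟨U, hUT.trans (hT.trans hS'le), hU0, hUp, hUprod⟩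
    · have hc := Multiset.card_sub hUT
      refine ⟨T - U, tsub_le_self.trans (hT.trans hS'le), ?_, by lia, ?_⟩
      · rw [← Multiset.card_pos]; lia
      · have h := congrArg Multiset.prod (tsub_add_cancel_of_le hUT)
        rw [Multiset.prod_add, hUprod, hprod, mul_one] at h
        exact h

end rankTwo

section finiteAbelian

variable {A : Type*} [CommGroup A] [Finite A] {S : Multiset A}

lemma card_le_ncard_subProducts_id (h : 1 ∉ subProducts (MonoidHom.id A) S) :
    S.card ≤ (subProducts (MonoidHom.id A) S).ncard := by
  have : IsMulCommutative A := ⟨⟨mul_comm⟩⟩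
  obtain ⟨T, hT, -, hTr⟩ := exists_le_ncard_subProducts (f := MonoidHom.id A) (k := 1) (l := 1)
    (S := S) (fun U _ hU ↦ by
      obtain ⟨a, ha⟩ := Multiset.card_pos_iff_exists_mem.1 hU
      exact ⟨{a}, by simpa using ha, by simp, a, {a}, le_rfl, by simp, [a], by simp⟩)
    S.card (by lia) (fun T hT _ h' ↦ h (subProducts_mono _ hT h'))
  exact hTr.trans (Set.ncard_le_ncard (subProducts_mono _ hT) (Set.toFinite _))

/-- The Davenport constant of a finite abelian group is at most its order. -/
lemma exists_le_prod_eq_one_of_natCard_le (h : Nat.card A ≤ S.card) :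
    ∃ T ≤ S, T ≠ 0 ∧ T.prod = 1 := by
  by_cases h1 : 1 ∈ subProducts (MonoidHom.id A) S
  · obtain ⟨T, hT, hT0, hT1⟩ := h1
    rw [orderedProducts_eq_singleton] at hT1
    exact ⟨T, hT, hT0, hT1.symm⟩
  · have h2 := card_le_ncard_subProducts_id h1
    have h3 := ncard_subProducts_lt h1
    lia

end finiteAbelian

/-! ### Groups whose centre has index the square of a prime -/

section center

variable {G V : Type*} [Group G] [CommGroup V] {p : ℕ} {π : G →* V}

lemma mem_ker_of_mem_orderedProducts {T : Multiset G} {a : G} (ha : a ∈ orderedProducts T)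
    (hprod : (T.map π).prod = 1) : a ∈ π.ker := by
  have h := map_mem_orderedProducts π ha
  rwa [orderedProducts_eq_singleton, hprod, Set.mem_singleton_iff] at h

lemma subProducts_center_nonempty (hker : π.ker = Subgroup.center G) {T : Multiset G}
    (hT : T ≠ 0) (hprod : (T.map π).prod = 1) :
    (subProducts (Subgroup.center G).subtype T).Nonempty := by
  obtain ⟨a, ha⟩ := orderedProducts_nonempty T
  exact ⟨⟨a, hker ▸ mem_ker_of_mem_orderedProducts ha hprod⟩, T, le_rfl, hT, ha⟩

/-- A sequence of more than `p` terms that is minimal among those with product one modulo the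
centre contains two noncommuting terms, since otherwise its image lies in a subgroup of order at
most `p`. Swapping these terms changes the product. -/
lemma two_le_ncard_subProducts_of_minimal [Finite G] [Fact p.Prime]
    (hker : π.ker = Subgroup.center G) (hV : Nat.card V = p ^ 2) {T : Multiset G}
    (hT : p < T.card) (hprod : (T.map π).prod = 1)
    (hmin : ∀ U ≤ T, U ≠ 0 → (U.map π).prod = 1 → T.card ≤ U.card) :
    2 ≤ (subProducts (Subgroup.center G).subtype T).ncard := by
  classical
  have hp : p.Prime := Fact.out
  have hT0 : T ≠ 0 := by rw [← Multiset.card_pos]; lia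
  obtain ⟨t, ht, s, hs, hts⟩ : ∃ t ∈ T, ∃ s ∈ T, t * s ≠ s * t := by
    by_contra! hcomm
    obtain ⟨t, ht⟩ := Multiset.exists_mem_of_ne_zero hT0
    have htc : π t ≠ 1 := fun h ↦ by
      have := hmin {t} (by simpa using ht) (by simp) (by simpa using h)
      have := hp.two_le
      simp only [Multiset.card_singleton] at *
      lia
    let A : Subgroup V := (Subgroup.centralizer {t}).map π
    have hA : Nat.card A ≤ p := by
      have hAtop : A ≠ ⊤ := fun h ↦ htc <| by
        have h2 := Subgroup.comap_map_eq π (Subgroup.centralizer {t})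
        rw [show (Subgroup.centralizer {t}).map π = ⊤ from h, Subgroup.comap_top, hker,
          sup_eq_left.2 (Subgroup.center_le_centralizer _)] at h2
        rw [← MonoidHom.mem_ker, hker, Subgroup.mem_center_iff]
        intro g
        have hg : g ∈ Subgroup.centralizer {t} := h2 ▸ Subgroup.mem_top g
        exact (Subgroup.mem_centralizer_singleton_iff.1 hg)
      have hdvd : Nat.card A ∣ p ^ 2 := hV ▸ Subgroup.card_subgroup_dvd_card A
      obtain ⟨k, hk, hAk⟩ := (Nat.dvd_prime_pow hp).1 hdvd
      have : Finite V := Nat.finite_of_card_ne_zero (by rw [hV]; exact pow_ne_zero 2 hp.ne_zero)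
      have hk2 : k ≠ 2 := by
        rintro rfl
        exact hAtop (Subgroup.eq_top_of_card_eq A (by rw [hAk, hV]))
      rw [hAk]
      exact (Nat.pow_le_pow_right hp.pos (show k ≤ 1 by lia)).trans (pow_one p).le
    obtain ⟨T₁, hT₁, hT₁c⟩ := exists_le_card_eq hT.le
    have hmem : ∀ a ∈ T₁, π a ∈ A := fun a ha ↦ Subgroup.mem_map_of_mem π
      (Subgroup.mem_centralizer_singleton_iff.2 (hcomm a (Multiset.mem_of_le hT₁ ha) t ht))
    let T₂ : Multiset A := T₁.pmap (fun a h ↦ ⟨π a, h⟩) hmem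
    have hT₂ : T₂.map A.subtype = T₁.map π := by
      rw [Multiset.map_pmap]
      exact Multiset.pmap_eq_map _ _ _ _
    have : Finite V := Nat.finite_of_card_ne_zero (by rw [hV]; exact pow_ne_zero 2 hp.ne_zero)
    obtain ⟨T₃, hT₃, hT₃0, hT₃1⟩ := exists_le_prod_eq_one_of_natCard_le (A := A) (S := T₂)
      (by simpa [T₂, hT₁c] using hA)
    obtain ⟨U, hU, hUmap⟩ := exists_le_map_eq π (hT₂ ▸ Multiset.map_le_map hT₃)
    have hUc := congrArg Multiset.card hUmap
    simp only [Multiset.card_map] at hUc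
    have h1 := hmin U (hU.trans hT₁)
      (by rw [← Multiset.card_pos, hUc]; exact Multiset.card_pos.2 hT₃0)
      (by rw [hUmap, ← map_multiset_prod, hT₃1, map_one])
    have h2 := Multiset.card_le_card hU
    lia
  have hst : s ∈ T.erase t := (Multiset.mem_erase_of_ne (by rintro rfl; exact hts rfl)).2 hs
  obtain ⟨x, hx⟩ := orderedProducts_nonempty ((T.erase t).erase s)
  have hsum : {t} + ({s} + (T.erase t).erase s) = T := by
    rw [Multiset.singleton_add, Multiset.singleton_add, Multiset.cons_erase hst,
      Multiset.cons_erase ht]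
  have hsum' : {s} + ({t} + (T.erase t).erase s) = T := by
    rw [add_left_comm]; exact hsum
  have hsing : ∀ a : G, a ∈ orderedProducts {a} := fun a ↦ ⟨[a], by simp⟩
  have h1 : t * (s * x) ∈ orderedProducts T :=
    hsum ▸ mul_mem_orderedProducts (hsing t) (mul_mem_orderedProducts (hsing s) hx)
  have h2 : s * (t * x) ∈ orderedProducts T :=
    hsum' ▸ mul_mem_orderedProducts (hsing s) (mul_mem_orderedProducts (hsing t) hx)
  have hcen : ∀ a ∈ orderedProducts T, a ∈ Subgroup.center G := fun a ha ↦
    hker ▸ mem_ker_of_mem_orderedProducts ha hprod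
  refine (Set.one_lt_ncard (Set.toFinite _)).2
    ⟨⟨_, hcen _ h1⟩, ⟨T, le_rfl, hT0, h1⟩, ⟨_, hcen _ h2⟩, ⟨T, le_rfl, hT0, h2⟩, fun h ↦ ?_⟩
  have h3 := congrArg Subtype.val h
  simp only [← mul_assoc] at h3
  exact hts (mul_right_cancel h3)

/-- Short zero-sum sequences modulo the centre are extracted greedily. The last one need not be
short, but in that case it contains noncommuting terms and so counts twice. -/
lemma hasShortProductOne_of_ker_eq_center [Finite G] [Fact p.Prime]
    (hπ : Function.Surjective π)
    (hker : π.ker = Subgroup.center G) (hV : Nat.card V = p ^ 2) (hexp : ∀ v : V, v ^ p = 1)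
    {S : Multiset G} (hS : p * Nat.card (Subgroup.center G) + p - 1 ≤ S.card) :
    HasShortProductOne S (p * Nat.card (Subgroup.center G)) := by
  classical
  have hp : p.Prime := Fact.out
  have hp2 := hp.two_le
  by_contra hfree
  obtain ⟨m, hm⟩ : ∃ m, Nat.card (Subgroup.center G) = m + 2 := by
    refine Nat.exists_eq_add_of_le' ?_
    by_contra! hlt
    have h1 := Subgroup.eq_bot_of_card_le _ (Nat.lt_succ_iff.1 hlt)
    have hinj : Function.Injective π := (MonoidHom.ker_eq_bot_iff π).1 (hker.trans h1)
    have htriv : ∀ a : G, π a = 1 := fun a ↦ by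
      rw [← MonoidHom.mem_ker, hker, Subgroup.mem_center_iff]
      exact fun b ↦ hinj (by rw [map_mul, map_mul, mul_comm])
    have : Subsingleton V := ⟨fun v w ↦ by
      obtain ⟨a, rfl⟩ := hπ v
      obtain ⟨b, rfl⟩ := hπ w
      rw [htriv, htriv]⟩
    have := Nat.card_of_subsingleton (1 : V)
    rw [hV] at this
    have := Nat.one_lt_pow two_ne_zero hp.one_lt
    lia
  set f := (Subgroup.center G).subtype with hf
  have hcard : p * Nat.card (Subgroup.center G) = m * p + 2 * p := by rw [hm]; ring
  rw [hcard] at hS hfree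
  have hshort : ∀ U : Multiset G, 3 * p - 2 ≤ U.card →
      ∃ T ≤ U, T.card ≤ p ∧ T ≠ 0 ∧ (T.map π).prod = 1 := by
    intro U hU
    obtain ⟨T', hT', hT'0, hT'c, hT'1⟩ := exists_short_le_prod_eq_one_of_card_sq hV hexp
      (S := U.map π) (by simpa using hU)
    obtain ⟨T, hT, rfl⟩ := exists_le_map_eq π hT'
    exact ⟨T, hT, by simpa using hT'c, by simpa using hT'0, hT'1⟩
  have hextract : ∀ U ≤ S, 3 * p - 2 ≤ U.card →
      ∃ T ≤ U, T.card ≤ p ∧ (subProducts f T).Nonempty := by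
    intro U _ hU
    obtain ⟨T, hT, hTc, hT0, hT1⟩ := hshort U hU
    exact ⟨T, hT, hTc, subProducts_center_nonempty hker hT0 hT1⟩
  obtain ⟨E, hE, hEc, hEm⟩ := exists_le_ncard_subProducts
    (C := Subgroup.center G) (f := f) (k := 3 * p - 2) (l := p) hextract m (by lia)
    (fun T hT hTc ↦ one_notMem_subProducts hfree hT (by lia))
  -- No short part of the remainder has two subproducts.
  have key : ∀ U ≤ S - E, U.card ≤ 2 * p → (subProducts f U).ncard < 2 := by
    intro U hU hUc
    by_contra! h2
    have hle : E + U ≤ S := (add_le_add le_rfl hU).trans (add_tsub_cancel_of_le hE).le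
    have hnot := one_notMem_subProducts (f := f) hfree hle (by rw [Multiset.card_add]; lia)
    have h3 := ncard_subProducts_add hnot
    have h4 := ncard_subProducts_lt hnot
    rw [hm] at h4
    lia
  have hRc := Multiset.card_sub hE
  obtain ⟨W, hW, hWc, hW0, hW1⟩ := hshort (S - E) (by lia)
  have hR'c := Multiset.card_sub hW
  obtain ⟨R, hR, hRc⟩ := exists_le_card_eq (S := S - E - W) (k := 2 * p - 1) (by lia)
  have hex : ∃ n, ∃ T ≤ R, T ≠ 0 ∧ (T.map π).prod = 1 ∧ T.card = n := by
    obtain ⟨T', hT', hT'0, hT'1⟩ := exists_le_prod_eq_one_of_card_sq hV hexp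
      (S := R.map π) (by simp [hRc])
    obtain ⟨T, hT, rfl⟩ := exists_le_map_eq π hT'
    exact ⟨_, T, hT, by simpa using hT'0, hT'1, rfl⟩
  obtain ⟨T, hT, hT0, hT1, hTc⟩ := Nat.find_spec hex
  have hmin : ∀ U ≤ T, U ≠ 0 → (U.map π).prod = 1 → T.card ≤ U.card := fun U hU hU0 hU1 ↦
    hTc ▸ Nat.find_min' hex ⟨U, hU.trans hT, hU0, hU1, rfl⟩
  have hTR := Multiset.card_le_card hT
  have hTle : T ≤ S - E - W := hT.trans hR
  by_cases hTp : T.card ≤ p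
  · have hle : W + T ≤ S - E := (add_le_add le_rfl hTle).trans (add_tsub_cancel_of_le hW).le
    have hc : (W + T).card ≤ 2 * p := by rw [Multiset.card_add]; lia
    have h1 := key _ hle hc
    have hnot := one_notMem_subProducts (f := f) hfree (hle.trans tsub_le_self)
      (by lia : (W + T).card ≤ m * p + 2 * p)
    have h2 := ncard_subProducts_add hnot
    have h3 := (Set.ncard_pos (Set.toFinite _)).2 (subProducts_center_nonempty hker hW0 hW1)
    have h4 := (Set.ncard_pos (Set.toFinite _)).2 (subProducts_center_nonempty hker hT0 hT1)
    lia
  · have h1 := two_le_ncard_subProducts_of_minimal hker hV (not_le.1 hTp) hT1 hmin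
    have h2 := key T (hTle.trans tsub_le_self) (by lia)
    lia

end center

/-! ### Frobenius groups with a kernel of prime order and a complement of prime order -/

section frobenius

variable {G Q : Type*} [Group G] [CommGroup Q] {π : G →* Q} {p q : ℕ}

/-- If conjugation by elements outside the kernel of `π` fixes no nontrivial element of the kernel,
then a sequence that is minimal with product one modulo the kernel has at least as many products
as terms: cyclic rotations of one product are conjugates of it by the partial products, and these
partial products are distinct modulo the kernel. -/
lemma card_le_ncard_subProducts_of_minimal [Finite G]
    (hfix : ∀ z ∉ π.ker, ∀ h ∈ π.ker, z * h = h * z → h = 1) {T : Multiset G} (hT0 : T ≠ 0)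
    (hprod : (T.map π).prod = 1) (hfree : 1 ∉ subProducts π.ker.subtype T)
    (hmin : ∀ U ≤ T, U ≠ 0 → (U.map π).prod = 1 → T.card ≤ U.card) :
    T.card ≤ (subProducts π.ker.subtype T).ncard := by
  obtain ⟨L, rfl⟩ : ∃ L : List G, (L : Multiset G) = T := Quot.exists_rep T
  have hrot : ∀ i, (L.rotate i).prod ∈ orderedProducts (L : Multiset G) := fun i ↦
    ⟨L.rotate i, Multiset.coe_eq_coe.2 (L.rotate_perm i), rfl⟩
  have hker : ∀ i, (L.rotate i).prod ∈ π.ker := fun i ↦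
    mem_ker_of_mem_orderedProducts (hrot i) hprod
  have hne : ∀ i, (L.rotate i).prod ≠ 1 := fun i h ↦
    hfree ⟨L, le_rfl, hT0, by simpa [← h] using hrot i⟩
  have hlt : ∀ i j, i < j → j < L.length → (L.rotate i).prod ≠ (L.rotate j).prod := by
    intro i j hij hj heq
    set M := (L.drop i).take (j - i) with hM
    have hMlen : M.length = j - i := by
      rw [hM, List.length_take, List.length_drop]
      lia
    have hMsub : M.Sublist L := (List.take_sublist _ _).trans (List.drop_sublist _ _)
    have htake : L.take j = L.take i ++ M := by
      rw [hM, ← List.take_add]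
      congr 1
      lia
    have hdrop : L.drop i = M ++ L.drop j := by
      have h := List.take_append_drop (j - i) (L.drop i)
      rw [List.drop_drop, Nat.add_sub_cancel' hij.le] at h
      exact h.symm
    have hMker : M.prod ∉ π.ker := by
      intro h
      have h1 := hmin M hMsub.subperm
        (by rw [← Multiset.card_pos, Multiset.coe_card, hMlen]; lia)
        (by rw [MonoidHom.mem_ker, map_list_prod] at h; simpa using h)
      rw [Multiset.coe_card, Multiset.coe_card, hMlen] at h1
      lia
    refine hne i (hfix _ hMker _ (hker i) ?_)
    have h1 : (L.rotate i).prod = M.prod * (L.drop j).prod * (L.take i).prod := by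
      rw [List.rotate_eq_drop_append_take (by lia), hdrop]
      simp [mul_assoc]
    have h2 : (L.rotate j).prod = (L.drop j).prod * (L.take i).prod * M.prod := by
      rw [List.rotate_eq_drop_append_take (by lia), htake]
      simp [mul_assoc]
    calc M.prod * (L.rotate i).prod = M.prod * (L.rotate j).prod := by rw [heq]
      _ = (L.rotate i).prod * M.prod := by rw [h1, h2]; simp only [mul_assoc]
  let g : Fin L.length → π.ker := fun i ↦ ⟨(L.rotate i).prod, hker i⟩
  calc (L : Multiset G).card = (Set.univ : Set (Fin L.length)).ncard := by
        rw [Set.ncard_univ, Nat.card_fin, Multiset.coe_card]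
    _ ≤ _ := Set.ncard_le_ncard_of_injOn g
        (show ∀ i ∈ Set.univ, g i ∈ subProducts π.ker.subtype L from
          fun i _ ↦ ⟨L, le_rfl, hT0, hrot i⟩) (fun i _ j _ hij ↦ by
          have h := congrArg Subtype.val hij
          rcases lt_trichotomy i.1 j.1 with hlt' | heq | hlt'
          · exact absurd h (hlt i j hlt' j.2)
          · exact Fin.ext heq
          · exact absurd h.symm (hlt j i hlt' i.2)) (Set.toFinite _)

/-- A sequence with product one modulo the kernel splits into minimal ones, and the number of
subproducts is superadditive. -/
lemma card_le_ncard_subProducts [Finite G] [IsMulCommutative π.ker]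
    (hfix : ∀ z ∉ π.ker, ∀ h ∈ π.ker, z * h = h * z → h = 1) {T : Multiset G}
    (hprod : (T.map π).prod = 1) (hfree : 1 ∉ subProducts π.ker.subtype T) :
    T.card ≤ (subProducts π.ker.subtype T).ncard := by
  classical
  induction hn : T.card using Nat.strong_induction_on generalizing T with
  | _ n ih =>
    subst hn
    by_cases hT0 : T = 0
    · simp [hT0]
    by_cases hmin : ∀ U ≤ T, U ≠ 0 → (U.map π).prod = 1 → T.card ≤ U.card
    · exact card_le_ncard_subProducts_of_minimal hfix hT0 hprod hfree hmin
    · push Not at hmin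
      obtain ⟨U, hU, hU0, hU1, hUc⟩ := hmin
      have hsum := add_tsub_cancel_of_le hU
      have hc := Multiset.card_sub hU
      have hpos := Multiset.card_pos.2 hU0
      have h1 := ih U.card hUc hU1 (fun h ↦ hfree (subProducts_mono _ hU h)) rfl
      have h2 := ih (T - U).card (by lia) (by
        rw [← hsum, Multiset.map_add, Multiset.prod_add, hU1, one_mul] at hprod
        exact hprod) (fun h ↦ hfree (subProducts_mono _ tsub_le_self h)) rfl
      have h3 := ncard_subProducts_add (f := π.ker.subtype) (hsum.symm ▸ hfree)
      rw [hsum] at h3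
      lia

/-- In a group of prime order `p`, a sequence of length at least `k + p - 1` in which no term occurs
more than `k` times has a zero-sum subsequence of length exactly `k`. -/
lemma exists_card_eq_prod_eq_one [Finite Q] (hp : p.Prime) (hQ : Nat.card Q = p) {k : ℕ}
    {S : Multiset Q} (hS : k + p - 1 ≤ S.card) (hk : ∀ c, ¬ Multiset.replicate (k + 1) c ≤ S) :
    ∃ T ≤ S, T.card = k ∧ T.prod = 1 := by
  have hp1 := hp.one_lt
  have h := min_le_ncard_products_of_card_eq (π := (1 : Q →* Q)) hp
    (by rw [MonoidHom.ker_one, Subgroup.card_top, hQ]) (c := 1) (by simp)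
    (k := k) (by lia) hk
  rw [min_eq_left (by lia), ← hQ, ← Set.ncard_univ] at h
  have huniv := Set.eq_of_subset_of_ncard_le (Set.subset_univ _) h
  obtain ⟨T, hT, hTc, hT1⟩ := huniv.symm ▸ Set.mem_univ (1 : Q)
  rw [orderedProducts_eq_singleton] at hT1
  exact ⟨T, hT, hTc, hT1.symm⟩

lemma pow_eq_one_of_notMem_ker (hQ : Nat.card Q = p)
    (hfix : ∀ z ∉ π.ker, ∀ h ∈ π.ker, z * h = h * z → h = 1) {z : G} (hz : z ∉ π.ker) :
    z ^ p = 1 := by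
  refine hfix z hz (z ^ p) ?_ (by rw [← pow_succ', ← pow_succ])
  rw [MonoidHom.mem_ker, map_pow, ← hQ, pow_card_eq_one']

/-- Conjugation by an element outside the kernel of `π` is an automorphism of order `p` of a group
of order `q`. -/
lemma dvd_sub_one_of_frobenius (hp : p.Prime) (hq : q.Prime) (hQ : Nat.card Q = p)
    (hker : Nat.card π.ker = q)
    (hfix : ∀ z ∉ π.ker, ∀ h ∈ π.ker, z * h = h * z → h = 1) {z : G} (hz : z ∉ π.ker) :
    p ∣ q - 1 := by
  have := Fact.mk hp
  have := Fact.mk hq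
  have : Finite π.ker := Nat.finite_of_card_ne_zero (hker ▸ hq.ne_zero)
  have hcyc : IsCyclic π.ker := isCyclic_of_prime_card hker
  have hnt : Nontrivial π.ker := Finite.one_lt_card_iff_nontrivial.1 (hker ▸ hq.one_lt)
  obtain ⟨h, hh⟩ := exists_ne (1 : π.ker)
  have hord : orderOf (MulAut.conjNormal z : MulAut π.ker) = p := by
    refine orderOf_eq_prime ?_ fun hone ↦ hh ?_
    · rw [← map_pow, pow_eq_one_of_notMem_ker hQ hfix hz, map_one]
    · have h1 := congrArg (fun φ : MulAut π.ker ↦ ((φ h : π.ker) : G)) hone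
      simp only [MulAut.conjNormal_apply, MulAut.one_apply] at h1
      exact Subtype.ext (hfix z hz h h.2 (mul_inv_eq_iff_eq_mul.1 h1))
  have hdvd := orderOf_dvd_natCard (MulAut.conjNormal z : MulAut π.ker)
  rwa [hord, IsCyclic.card_mulAut, hker, Nat.totient_prime hq] at hdvd

/-- The products of `p` terms of a long sequence inside one nontrivial coset of the kernel exhaust
the nontrivial elements of the kernel. Cauchy–Davenport leaves fewer than `p` exceptions, whereas
the exceptions form full conjugation orbits, of size `p`. If the sequence had `q + p - 1` terms,
then Cauchy–Davenport would even yield the product `1`. -/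
lemma exists_card_eq_mem_orderedProducts [Finite G] [IsMulCommutative π.ker] (hp : p.Prime)
    (hq : q.Prime) (hQ : Nat.card Q = p) (hker : Nat.card π.ker = q)
    (hfix : ∀ z ∉ π.ker, ∀ h ∈ π.ker, z * h = h * z → h = 1) {S : Multiset G}
    (hfree : ¬ HasShortProductOne S q) {c : Q} (hc1 : c ≠ 1) (hc : ∀ a ∈ S, π a = c)
    (hS : q - 1 ≤ S.card) :
    S.card + 1 < q + p ∧
      ∀ h ∈ π.ker, h ≠ 1 → ∃ T ≤ S, T.card = p ∧ h ∈ orderedProducts T := by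
  have hp1 := hp.one_lt
  have hq1 := hq.one_lt
  obtain ⟨z, hz⟩ := Multiset.card_pos_iff_exists_mem.1 (show 0 < S.card by lia)
  have hzc := hc z hz
  have hcp : c ^ p = 1 := by rw [← hQ, pow_card_eq_one']
  have hnot : ∀ a ∈ S, a ∉ π.ker := fun a ha h ↦ hc1 ((hc a ha).symm.trans h)
  have hpq : p < q := by
    have h1 := dvd_sub_one_of_frobenius hp hq hQ hker hfix (hnot z hz)
    have := Nat.le_of_dvd (by lia) h1
    lia
  set A : Set G := {a : G | ∃ T ≤ S, T.card = p ∧ a ∈ orderedProducts T} with hA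
  have hprod : ∀ T ≤ S, T.card = p → (T.map π).prod = 1 := by
    intro T hT hTc
    rw [Multiset.map_congr rfl fun a ha ↦ hc a (Multiset.mem_of_le hT ha), Multiset.map_const',
      Multiset.prod_replicate, hTc, hcp]
  have hAker : A ⊆ π.ker := fun a ⟨T, hT, hTc, ha⟩ ↦
    mem_ker_of_mem_orderedProducts ha (hprod T hT hTc)
  have hA1 : (1 : G) ∉ A := fun ⟨T, hT, hTc, h1⟩ ↦
    hfree ⟨T, hT, by rw [← Multiset.card_pos]; lia, by lia, h1⟩
  have hkern : (π.ker : Set G).ncard = q := by rw [← hker]; rfl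
  have hbound : min q (S.card + 1 - p) ≤ A.ncard := by
    refine min_le_ncard_products_of_card_eq hq hker hc (by lia) fun a ha ↦ ?_
    have ha' : a ∈ S := Multiset.mem_of_le ha (Multiset.mem_replicate.2 ⟨by lia, rfl⟩)
    refine hfree ⟨Multiset.replicate p a,
      ((Multiset.replicate_le_replicate a).2 (Nat.le_succ p)).trans ha, ?_,
      (Multiset.card_replicate p a).trans_le hpq.le,
      List.replicate p a, rfl, ?_⟩
    · rw [← Multiset.card_pos, Multiset.card_replicate]; lia
    · rw [List.prod_replicate, pow_eq_one_of_notMem_ker hQ hfix (hnot a ha')]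
  have hAlt : A.ncard < q := by
    rw [← hkern]
    refine Set.ncard_lt_ncard ⟨hAker, fun h ↦ hA1 (h (one_mem π.ker))⟩ (Set.toFinite _)
  refine ⟨by grind, fun h hh hh1 ↦ ?_⟩
  by_contra hhA
  change h ∉ A at hhA
  -- Rotating a product conjugates it by a term, and all terms act alike on the abelian kernel.
  have hconj : ∀ a, z * a * z⁻¹ ∈ A → a ∈ A := by
    rintro a ⟨T, hT, hTc, L, rfl, hL⟩
    cases L with
    | nil => simp at hTc; lia
    | cons w L =>
      have hw : π w = c := hc w (Multiset.mem_of_le hT (by simp))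
      rw [List.prod_cons] at hL
      have hx : L.prod * w ∈ π.ker := by
        refine mem_ker_of_mem_orderedProducts ⟨L ++ [w], rfl, by simp⟩ ?_
        refine hprod _ ?_ ?_
        · rwa [Multiset.coe_eq_coe.2 (List.perm_append_singleton w L)]
        · rwa [Multiset.coe_eq_coe.2 (List.perm_append_singleton w L)]
      have hy : z⁻¹ * w ∈ π.ker := by
        rw [MonoidHom.mem_ker, map_mul, map_inv, hw, hzc, inv_mul_cancel]
      have hcomm : (z⁻¹ * w) * (L.prod * w) = (L.prod * w) * (z⁻¹ * w) :=
        congrArg Subtype.val (mul_comm' (⟨_, hy⟩ : π.ker) ⟨_, hx⟩)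
      have ha : a = L.prod * w := by
        have h1 : a = z⁻¹ * (w * L.prod) * z := by rw [hL]; group
        have h2 : z⁻¹ * (w * L.prod) * w = L.prod * w * z⁻¹ * w := by
          simpa only [mul_assoc] using hcomm
        have h3 := mul_right_cancel h2
        rw [h1, h3]
        group
      exact ⟨_, hT, hTc, L ++ [w], Multiset.coe_eq_coe.2 (List.perm_append_singleton w L),
        by simp [ha]⟩
  let g : Fin p → G := fun i ↦ z ^ i.1 * h * (z ^ i.1)⁻¹
  have hgker : ∀ i, g i ∈ π.ker := fun i ↦ π.normal_ker.conj_mem h hh _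
  have hgA : ∀ i : ℕ, z ^ i * h * (z ^ i)⁻¹ ∉ A := by
    intro i
    induction i with
    | zero => simpa using hhA
    | succ i ih =>
      intro h1
      refine ih (hconj _ ?_)
      rw [pow_succ'] at h1
      simpa only [mul_inv_rev, mul_assoc] using h1
  have hord : orderOf c = p := by
    have := Fact.mk hp
    exact orderOf_eq_prime hcp hc1
  have hlt : ∀ i j : ℕ, i < j → j < p → z ^ i * h * (z ^ i)⁻¹ ≠ z ^ j * h * (z ^ j)⁻¹ := by
    intro i j hij hj heq
    refine hh1 (hfix (z ^ (j - i)) (fun hmem ↦ ?_) h hh ?_)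
    · rw [MonoidHom.mem_ker, map_pow, hzc] at hmem
      have := Nat.le_of_dvd (by lia) (orderOf_dvd_of_pow_eq_one hmem)
      lia
    · obtain ⟨k, rfl⟩ := Nat.exists_eq_add_of_lt hij
      rw [show i + k + 1 - i = k + 1 by lia]
      rw [show i + k + 1 = i + (k + 1) by lia, pow_add, mul_inv_rev] at heq
      have h1 : z ^ i * (h * (z ^ i)⁻¹) =
          z ^ i * (z ^ (k + 1) * h * (z ^ (k + 1))⁻¹ * (z ^ i)⁻¹) := by
        simpa only [mul_assoc] using heq
      have h2 := mul_right_cancel (mul_left_cancel h1)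
      exact (eq_mul_inv_iff_mul_eq.1 h2).symm
  have hginj : Function.Injective g := by
    intro i j hij
    rcases lt_trichotomy i.1 j.1 with h1 | h1 | h1
    · exact absurd hij (hlt i j h1 j.2)
    · exact Fin.ext h1
    · exact absurd hij.symm (hlt j i h1 i.2)
  have hrange : (Set.range g).ncard = p := by
    rw [← Set.image_univ, Set.ncard_image_of_injective _ hginj, Set.ncard_univ, Nat.card_fin]
  have hdisj : Disjoint A (Set.range g) := Set.disjoint_right.2 (by
    rintro _ ⟨i, rfl⟩
    exact hgA i)
  have hone : (1 : G) ∉ A ∪ Set.range g := by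
    rintro (h1 | ⟨i, hi⟩)
    · exact hA1 h1
    · refine hh1 ?_
      have h2 : z ^ i.1 * h = z ^ i.1 := by simpa using mul_inv_eq_iff_eq_mul.1 hi
      simpa using h2
  have hcount : (insert 1 (A ∪ Set.range g)).ncard ≤ (π.ker : Set G).ncard := by
    refine Set.ncard_le_ncard ?_ (Set.toFinite _)
    refine Set.insert_subset (one_mem π.ker) (Set.union_subset hAker ?_)
    rintro _ ⟨i, rfl⟩
    exact hgker i
  rw [Set.ncard_insert_of_notMem hone (Set.toFinite _),
    Set.ncard_union_eq hdisj (Set.toFinite _) (Set.toFinite _), hrange, hkern] at hcount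
  grind

/-- By the count of subproducts, `q` terms with product one modulo a kernel of order `q` are
enough. -/
lemma hasShortProductOne_of_card_eq [Finite G] [IsMulCommutative π.ker]
    (hker : Nat.card π.ker = q)
    (hfix : ∀ z ∉ π.ker, ∀ h ∈ π.ker, z * h = h * z → h = 1) {S T : Multiset G} (hT : T ≤ S)
    (hTc : T.card = q) (hprod : (T.map π).prod = 1) : HasShortProductOne S q := by
  by_contra hfree
  have hnot := one_notMem_subProducts (f := π.ker.subtype) hfree hT hTc.le
  have h1 := card_le_ncard_subProducts hfix hprod hnot
  have h2 := ncard_subProducts_lt hnot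
  lia

/-- In a cyclic group of prime order `p` generated by `c`, some nonempty subsequence of a given
sequence of `k < p` terms together with at most `p - k` copies of `c` has product one. -/
lemma exists_prod_mul_pow_eq_one [Finite Q] (hp : p.Prime) (hQ : Nat.card Q = p) {c : Q}
    (hc : c ≠ 1) {S : Multiset Q} (hS0 : 0 < S.card) (hSp : S.card < p) :
    ∃ T ≤ S, T ≠ 0 ∧ ∃ w ≤ p - S.card, T.prod * c ^ w = 1 := by
  classical
  by_cases hfree : 1 ∈ subProducts (MonoidHom.id Q) S
  · obtain ⟨T, hT, hT0, hT1⟩ := hfree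
    rw [orderedProducts_eq_singleton] at hT1
    exact ⟨T, hT, hT0, 0, Nat.zero_le _, by rw [pow_zero, mul_one]; exact hT1.symm⟩
  have hTr := card_le_ncard_subProducts_id hfree
  have hord : orderOf c = p := by
    have := Fact.mk hp
    exact orderOf_eq_prime (by rw [← hQ, pow_card_eq_one']) hc
  let g : Fin (p - S.card + 1) → Q := fun w ↦ (c ^ w.1)⁻¹
  have hginj : Function.Injective g := by
    intro i j hij
    refine Fin.ext (pow_injOn_Iio_orderOf ?_ ?_ (inv_injective hij)) <;>
    · simp only [Set.mem_Iio, hord]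
      lia
  have hrange : (Set.range g).ncard = p - S.card + 1 := by
    rw [← Set.image_univ, Set.ncard_image_of_injective _ hginj, Set.ncard_univ, Nat.card_fin]
  obtain ⟨a, ⟨U, hU, hU0, hUa⟩, w, rfl⟩ :
      (subProducts (MonoidHom.id Q) S ∩ Set.range g).Nonempty := by
    rw [← Set.not_disjoint_iff_nonempty_inter]
    intro hdisj
    have h1 := Set.ncard_union_eq hdisj (Set.toFinite _) (Set.toFinite _)
    have h2 := Set.ncard_le_ncard (Set.subset_univ (subProducts (MonoidHom.id Q) S ∪ Set.range g))
      (Set.toFinite _)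
    rw [Set.ncard_univ, hQ] at h2
    lia
  rw [orderedProducts_eq_singleton, Set.mem_singleton_iff] at hUa
  refine ⟨U, hU, hU0, w.1, by lia, ?_⟩
  rw [← hUa]
  simp [g]

/-- The case of a Frobenius group. Unless one nontrivial coset `c` of the kernel contains more than
`q` terms, some `q` terms have a product in the kernel, and the count of their subproducts
suffices. Otherwise a product in the kernel involving terms outside the coset `c` is cancelled by a
product of `p` terms in that coset. -/
lemma hasShortProductOne_of_frobenius [Finite G] [IsMulCommutative π.ker] (hp : p.Prime)
    (hq : q.Prime) (hQ : Nat.card Q = p) (hker : Nat.card π.ker = q)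
    (hfix : ∀ z ∉ π.ker, ∀ h ∈ π.ker, z * h = h * z → h = 1) {S : Multiset G}
    (hS : q + p - 1 ≤ S.card) : HasShortProductOne S q := by
  classical
  have hp1 := hp.one_lt
  have hq1 := hq.one_lt
  have : Finite Q := Nat.finite_of_card_ne_zero (hQ ▸ hp.ne_zero)
  obtain ⟨S', hS', hS'c⟩ := exists_le_card_eq hS
  refine HasShortProductOne.mono ?_ hS' le_rfl
  clear hS hS' S
  rename Multiset G => S
  by_cases hmult : ∀ c, ¬ Multiset.replicate (q + 1) c ≤ S.map π
  · obtain ⟨T', hT', hT'c, hT'1⟩ := exists_card_eq_prod_eq_one hp hQ (by simp [hS'c]) hmult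
    obtain ⟨T, hT, rfl⟩ := exists_le_map_eq π hT'
    exact hasShortProductOne_of_card_eq hker hfix hT (by simpa using hT'c) hT'1
  push Not at hmult
  obtain ⟨c, hc⟩ := hmult
  by_cases hc1 : c = 1
  · subst hc1
    obtain ⟨T, hT, hTmap⟩ := exists_le_map_eq π
      (((Multiset.replicate_le_replicate (1 : Q)).2 (Nat.le_succ q)).trans hc)
    have hTc := congrArg Multiset.card hTmap
    rw [Multiset.card_map, Multiset.card_replicate] at hTc
    exact hasShortProductOne_of_card_eq hker hfix hT hTc (by rw [hTmap]; simp)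
  by_contra hfree
  set S₁ := S.filter fun a ↦ π a = c with hS₁
  set S₂ := S.filter fun a ↦ ¬ π a = c with hS₂
  have hadd : S₁ + S₂ = S := Multiset.filter_add_not _ S
  have hcadd := congrArg Multiset.card hadd
  rw [Multiset.card_add, hS'c] at hcadd
  have hS₁c : q + 1 ≤ S₁.card := by
    have h1 := Multiset.le_count_iff_replicate_le.2 hc
    rw [Multiset.count_map] at h1
    simpa only [hS₁, eq_comm] using h1
  have hS₁le : S₁ ≤ S := Multiset.filter_le _ _
  have hmem : ∀ a ∈ S₁, π a = c := fun a ha ↦ (Multiset.mem_filter.1 ha).2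
  have hlt := (exists_card_eq_mem_orderedProducts hp hq hQ hker hfix
    (fun h ↦ hfree (h.mono hS₁le le_rfl)) hc1 hmem (by lia)).1
  obtain ⟨T', hT', hT'0, w, hw, hT'w⟩ := exists_prod_mul_pow_eq_one hp hQ hc1
    (S := S₂.map π) (by rw [Multiset.card_map]; lia) (by rw [Multiset.card_map]; lia)
  rw [Multiset.card_map] at hw
  obtain ⟨T₂, hT₂, rfl⟩ := exists_le_map_eq π hT'
  obtain ⟨T₁, hT₁, hT₁c⟩ := exists_le_card_eq (S := S₁) (k := w) (by lia)
  have hT₂c := Multiset.card_le_card hT₂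
  have hUc := Multiset.card_sub hT₁
  have hU := (exists_card_eq_mem_orderedProducts hp hq hQ hker hfix (S := S₁ - T₁)
    (fun h ↦ hfree (h.mono (tsub_le_self.trans hS₁le) le_rfl)) hc1
    (fun a ha ↦ hmem a (Multiset.mem_of_le tsub_le_self ha)) (by lia)).2
  have hWprod : ((T₂ + T₁).map π).prod = 1 := by
    rw [Multiset.map_add, Multiset.prod_add,
      Multiset.map_congr rfl fun a ha ↦ hmem a (Multiset.mem_of_le hT₁ ha), Multiset.map_const',
      Multiset.prod_replicate, hT₁c, hT'w]
  have hW0 : T₂ + T₁ ≠ 0 := fun h ↦ hT'0 (by simp [(add_eq_zero.1 h).1])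
  have hWS : T₂ + T₁ ≤ S := by
    rw [← hadd, add_comm S₁]
    exact add_le_add hT₂ hT₁
  -- Here `p ≥ 3`, so the divisibility `p ∣ q - 1` forces `2 * p < q`.
  have hpq : 2 * p < q := by
    obtain ⟨z, hz⟩ := Multiset.card_pos_iff_exists_mem.1 (show 0 < S₁.card by lia)
    obtain ⟨k, hk⟩ := dvd_sub_one_of_frobenius hp hq hQ hker hfix (z := z)
      (fun h ↦ hc1 ((hmem z hz).symm.trans h))
    have hk0 : k ≠ 0 := by rintro rfl; lia
    have hk1 : k ≠ 1 := by
      rintro rfl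
      have h1 := hp.eq_two_or_odd
      have h2 := hq.eq_two_or_odd
      lia
    have := Nat.mul_le_mul_left p (show 2 ≤ k by lia)
    lia
  obtain ⟨h, hh⟩ := orderedProducts_nonempty (T₂ + T₁)
  have hhker := mem_ker_of_mem_orderedProducts hh hWprod
  by_cases hh1 : h = 1
  · exact hfree ⟨T₂ + T₁, hWS, hW0, by rw [Multiset.card_add]; lia, hh1 ▸ hh⟩
  · obtain ⟨T, hT, hTc, hTh⟩ := hU h⁻¹ (inv_mem hhker) (inv_ne_one.2 hh1)
    refine hfree ⟨T₂ + T₁ + T, ?_, by simp_all, ?_, ?_⟩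
    · rw [← hadd, add_comm S₁, add_assoc]
      refine add_le_add hT₂ ?_
      calc T₁ + T ≤ T₁ + (S₁ - T₁) := add_le_add le_rfl hT
        _ = S₁ := add_tsub_cancel_of_le hT₁
    · simp only [Multiset.card_add]
      lia
    · have := mul_mem_orderedProducts hh hTh
      rwa [mul_inv_cancel] at this

end frobenius

/-! ### Nonabelian groups with a cyclic normal subgroup of prime index -/

section primeIndex

variable {G : Type*} [Group G] {X : Subgroup G}

lemma normal_of_le_of_isCyclic [X.Normal] [IsCyclic X] {N : Subgroup G} (hN : N ≤ X) :
    N.Normal := by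
  refine ⟨fun h hh g ↦ ?_⟩
  obtain ⟨m, hm⟩ := MonoidHom.map_cyclic (MulAut.conjNormal g : MulAut X).toMonoidHom
  have h1 : g * h * g⁻¹ = h ^ m := congrArg Subtype.val (hm ⟨h, hN hh⟩)
  rw [h1]
  exact zpow_mem hh m

lemma eq_top_of_le_of_index_prime {p : ℕ} (hp : p.Prime) (hidx : X.index = p) {H : Subgroup G}
    (hH : X ≤ H) {z : G} (hz : z ∈ H) (hzX : z ∉ X) : H = ⊤ := by
  have h := Subgroup.relIndex_mul_index hH
  rw [hidx] at h
  rcases hp.eq_one_or_self_of_dvd _ ⟨_, h.symm⟩ with h1 | h1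
  · exact absurd (Subgroup.relIndex_eq_one.1 h1 hz) hzX
  · rw [h1] at h
    exact Subgroup.index_eq_one.1 (Nat.eq_of_mul_eq_mul_left hp.pos (by simpa using h))

/-- An element of `X` that commutes with some element outside `X` is central. -/
lemma mem_center_of_commute [IsMulCommutative X] {p : ℕ} (hp : p.Prime) (hidx : X.index = p)
    {h z : G} (hh : h ∈ X) (hz : z ∉ X) (hcomm : z * h = h * z) : h ∈ Subgroup.center G := by
  have htop : Subgroup.centralizer {h} = ⊤ := by
    refine eq_top_of_le_of_index_prime hp hidx (fun x hx ↦ ?_)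
      (Subgroup.mem_centralizer_singleton_iff.2 hcomm) hz
    exact Subgroup.mem_centralizer_singleton_iff.2
      (congrArg Subtype.val (mul_comm' (⟨x, hx⟩ : X) ⟨h, hh⟩))
  rw [Subgroup.mem_center_iff]
  intro g
  exact Subgroup.mem_centralizer_singleton_iff.1 (htop ▸ Subgroup.mem_top g)

lemma isMulCommutative_of_le_center [X.Normal] {p : ℕ} (hp : p.Prime) (hidx : X.index = p)
    (hX : X ≤ Subgroup.center G) : IsMulCommutative G := by
  have := Fact.mk hp
  have : IsCyclic (G ⧸ X) := isCyclic_of_prime_card (p := p) hidx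
  exact (QuotientGroup.mk' X).isMulCommutative_of_isCyclic_of_ker_le_center
    (by rwa [QuotientGroup.ker_mk'])

lemma center_le_of_index_prime [X.Normal] [IsMulCommutative X] {p : ℕ} (hp : p.Prime)
    (hidx : X.index = p) (hG : ¬ IsMulCommutative G) : Subgroup.center G ≤ X := by
  intro z hz
  by_contra hzX
  exact hG (isMulCommutative_of_le_center hp hidx fun h hh ↦
    mem_center_of_commute hp hidx hh hzX ((Subgroup.mem_center_iff.1 hz h).symm))

lemma exists_le_card_prime [Finite G] (hX : X ≠ ⊥) :
    ∃ N ≤ X, (Nat.card N).Prime := by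
  obtain ⟨r, hr, hrX⟩ := Nat.exists_prime_and_dvd (mt Subgroup.card_eq_one.1 hX)
  have := Fact.mk hr
  obtain ⟨x, hx⟩ := exists_prime_orderOf_dvd_card' r hrX
  refine ⟨Subgroup.zpowers (x : G), by simp, ?_⟩
  rw [Nat.card_zpowers, Subgroup.orderOf_coe, hx]
  exact hr

lemma mul_mul_inv_mem_of_commutator_le {N : Subgroup G} (hN : commutator G ≤ N) (x z : G) :
    x * z * x⁻¹ * z⁻¹ ∈ N :=
  hN (Subgroup.commutator_mem_commutator (Subgroup.mem_top x) (Subgroup.mem_top z))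

/-- If the centre is trivial and the commutator subgroup has prime order, then the commutator map
with a fixed element outside `X` embeds `X` into it. -/
lemma card_prime_of_center_eq_bot [Finite G] [IsMulCommutative X] {p : ℕ} (hp : p.Prime)
    (hidx : X.index = p) (hX : X ≠ ⊥) (hcen : Subgroup.center G = ⊥)
    (hcomm : ∀ N ≤ X, (Nat.card N).Prime → commutator G ≤ N) : (Nat.card X).Prime := by
  obtain ⟨N, hN, hNp⟩ := exists_le_card_prime hX
  obtain ⟨z, hz⟩ : ∃ z, z ∉ X := by
    by_contra! h
    rw [Subgroup.index_eq_one.2 ((Subgroup.eq_top_iff' X).2 h)] at hidx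
    exact hp.one_lt.ne hidx
  let φ : X → N := fun x ↦ ⟨_, mul_mul_inv_mem_of_commutator_le (hcomm N hN hNp) x z⟩
  have hφ : Function.Injective φ := by
    intro x y hxy
    have h1 : (x : G) * z * (x : G)⁻¹ = y * z * (y : G)⁻¹ :=
      mul_right_cancel (congrArg Subtype.val hxy)
    have h2 : z * ((y : G)⁻¹ * x) = (y : G)⁻¹ * x * z := by
      calc z * ((y : G)⁻¹ * x) = (y : G)⁻¹ * (y * z * (y : G)⁻¹) * x := by group
        _ = (y : G)⁻¹ * x * z := by rw [← h1]; group
    have h3 := mem_center_of_commute hp hidx (mul_mem (inv_mem y.2) x.2) hz h2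
    rw [hcen, Subgroup.mem_bot, inv_mul_eq_one] at h3
    exact Subtype.ext h3.symm
  have hle := Nat.card_le_card_of_injective φ hφ
  rwa [← Subgroup.eq_of_le_of_card_ge hN hle]

/-- If the centre contains the commutator subgroup, of prime order, then the commutator map with a
fixed element `z` outside `X` is a homomorphism from `X` whose kernel is the centre, and its
values are killed by `p` because `z ^ p ∈ X` commutes with `X`. -/
lemma card_eq_mul_card_center [Finite G] [X.Normal] [IsMulCommutative X] {p : ℕ} (hp : p.Prime)
    (hidx : X.index = p) (hG : ¬ IsMulCommutative G) (hcen : Subgroup.center G ≠ ⊥)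
    (hcomm : ∀ N ≤ X, (Nat.card N).Prime → commutator G ≤ N) :
    Nat.card X = p * Nat.card (Subgroup.center G) := by
  have hZX := center_le_of_index_prime hp hidx hG
  obtain ⟨N, hNZ, hNp⟩ := exists_le_card_prime hcen
  have hNcomm := hcomm N (hNZ.trans hZX) hNp
  obtain ⟨z, hz⟩ : ∃ z, z ∉ X := by
    by_contra! h
    rw [Subgroup.index_eq_one.2 ((Subgroup.eq_top_iff' X).2 h)] at hidx
    exact hp.one_lt.ne hidx
  let φ : X →* N :=
    { toFun := fun x ↦ ⟨_, mul_mul_inv_mem_of_commutator_le hNcomm x z⟩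
      map_one' := Subtype.ext (by simp)
      map_mul' := fun x y ↦ Subtype.ext (by
        have h := Subgroup.mem_center_iff.1
          (hNZ (mul_mul_inv_mem_of_commutator_le hNcomm (y : G) z)) x
        calc ((x * y : X) : G) * z * ((x * y : X) : G)⁻¹ * z⁻¹
            = (x * (y * z * (y : G)⁻¹ * z⁻¹)) * (z * (x : G)⁻¹ * z⁻¹) := by
              simp only [Subgroup.coe_mul]; group
          _ = (y * z * (y : G)⁻¹ * z⁻¹) * (x * z * (x : G)⁻¹ * z⁻¹) := by rw [h]; group
          _ = (x * z * (x : G)⁻¹ * z⁻¹) * (y * z * (y : G)⁻¹ * z⁻¹) :=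
            Subgroup.mem_center_iff.1
              (hNZ (mul_mul_inv_mem_of_commutator_le hNcomm (x : G) z)) _) }
  have hφker : ∀ x : X, φ x = 1 ↔ (x : G) ∈ Subgroup.center G := by
    intro x
    have h1 : φ x = 1 ↔ (x : G) * z = z * x := by
      rw [Subtype.ext_iff]
      change (x : G) * z * (x : G)⁻¹ * z⁻¹ = 1 ↔ _
      rw [mul_inv_eq_one, mul_inv_eq_iff_eq_mul]
    rw [h1]
    exact ⟨fun h ↦ mem_center_of_commute hp hidx x.2 hz h.symm,
      fun h ↦ (Subgroup.mem_center_iff.1 h z).symm⟩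
  have hpow : ∀ x : X, φ x ^ p = 1 := by
    intro x
    have hzp : z ^ p ∈ X := by
      rw [← hidx]
      exact Subgroup.pow_index_mem X z
    have hc : ((φ x : N) : G) * z = x * z * (x : G)⁻¹ :=
      inv_mul_cancel_right _ _
    have h1 : ((φ x : N) : G) ^ p * z ^ p = x * z ^ p * (x : G)⁻¹ := by
      rw [← conj_pow, ← hc]
      exact (Commute.mul_pow (Subgroup.mem_center_iff.1 (hNZ (φ x).2) z).symm p).symm
    have h2 : (x : G) * z ^ p = z ^ p * x :=
      congrArg Subtype.val (mul_comm' x (⟨z ^ p, hzp⟩ : X))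
    rw [h2, mul_inv_cancel_right] at h1
    exact Subtype.ext (by simpa using h1)
  obtain ⟨x, hx⟩ : ∃ x : X, φ x ≠ 1 := by
    by_contra! h
    exact hG (isMulCommutative_of_le_center hp hidx fun x hx ↦ (hφker ⟨x, hx⟩).1 (h _))
  have hNcard : Nat.card N = p := by
    have hord := orderOf_dvd_natCard (φ x)
    have h1 : orderOf (φ x) ≠ 1 := mt orderOf_eq_one_iff.1 hx
    have h2 := (hNp.eq_one_or_self_of_dvd _ hord).resolve_left h1
    have h3 := (hp.eq_one_or_self_of_dvd _ (orderOf_dvd_of_pow_eq_one (hpow x))).resolve_left h1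
    exact h2.symm.trans h3
  have hrange : Nat.card φ.range = p := by
    have hdvd := Subgroup.card_subgroup_dvd_card φ.range
    rw [hNcard] at hdvd
    refine (hp.eq_one_or_self_of_dvd _ hdvd).resolve_left fun h ↦ hx ?_
    have := Subgroup.card_eq_one.1 h
    have hmem : φ x ∈ φ.range := ⟨x, rfl⟩
    rwa [this, Subgroup.mem_bot] at hmem
  have hkerc : φ.ker = (Subgroup.center G).subgroupOf X := by
    ext x
    rw [MonoidHom.mem_ker, hφker, Subgroup.mem_subgroupOf]
  have hmul := Subgroup.index_mul_card φ.ker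
  rw [Subgroup.index_ker, hrange, hkerc, Nat.card_congr (Subgroup.subgroupOfEquivOfLe hZX).toEquiv]
    at hmul
  exact hmul.symm

end primeIndex

/-- In a finite nonabelian group with a cyclic normal subgroup `X` of prime index `p`, every sequence
of length `|X| + p - 1` has a product-one subsequence of length at most `|X|`. The induction
passes to a nonabelian quotient by a subgroup of `X` of prime order, as long as there is one. -/
theorem hasShortProductOne_of_isCyclic_of_index_prime {p : ℕ} (hp : p.Prime) {G : Type*} [Group G]
    [Finite G] (X : Subgroup G) [X.Normal] [IsCyclic X] (hidx : X.index = p)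
    (hG : ¬ IsMulCommutative G) {S : Multiset G} (hS : Nat.card X + p - 1 ≤ S.card) :
    HasShortProductOne S (Nat.card X) := by
  induction hn : Nat.card X using Nat.strong_induction_on generalizing G with
  | _ n ih =>
    have := Fact.mk hp
    have hp1 := hp.one_lt
    by_cases hquot : ∃ N ≤ X, (Nat.card N).Prime ∧ ¬ commutator G ≤ N
    · obtain ⟨N, hN, hNp, hNcomm⟩ := hquot
      have : N.Normal := normal_of_le_of_isCyclic hN
      have := Fact.mk hNp
      have : IsCyclic N := isCyclic_of_prime_card (p := Nat.card N) rfl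
      let X' := X.map (QuotientGroup.mk' N)
      have : X'.Normal := Subgroup.Normal.map inferInstance _ (QuotientGroup.mk'_surjective N)
      have : IsCyclic X' := isCyclic_of_surjective _
        ((QuotientGroup.mk' N).subgroupMap_surjective X)
      have hidx' : X'.index = p := by
        rw [← hidx]
        exact Subgroup.index_map_eq X (QuotientGroup.mk'_surjective N)
          (by rwa [QuotientGroup.ker_mk'])
      have hcard : n = Nat.card N * Nat.card X' := by
        have h1 := Subgroup.card_mul_index X
        have h2 := Subgroup.card_mul_index X'
        have h3 := Subgroup.card_eq_card_quotient_mul_card_subgroup N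
        rw [hidx, hn] at h1
        rw [hidx'] at h2
        rw [← h1, ← h2] at h3
        refine Nat.eq_of_mul_eq_mul_right hp.pos ?_
        rw [h3]
        ring
      have hX'pos : 0 < Nat.card X' := Nat.card_pos
      have hlt : Nat.card X' < n := by
        rw [hcard]
        exact lt_mul_left hX'pos hNp.one_lt
      have hG' : ¬ IsMulCommutative (G ⧸ N) :=
        mt Subgroup.Normal.quotient_commutative_iff_commutator_le.1 hNcomm
      by_contra hfree
      have hextract : ∀ U ≤ S, Nat.card X' + p - 1 ≤ U.card →
          ∃ T ≤ U, T.card ≤ Nat.card X' ∧ (subProducts N.subtype T).Nonempty := by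
        intro U _ hU
        obtain ⟨T', hT', hT'0, hT'c, hT'1⟩ := ih (Nat.card X') hlt X' hidx' hG'
          (S := U.map (QuotientGroup.mk' N)) (by rwa [Multiset.card_map]) rfl
        obtain ⟨T, hT, rfl⟩ := exists_le_map_eq _ hT'
        obtain ⟨a, ha, ha1⟩ := exists_mem_orderedProducts_of_map _ hT'1
        have haN : a ∈ N := by
          rw [← QuotientGroup.ker_mk' N]
          exact ha1
        exact ⟨T, hT, by simpa using hT'c, ⟨a, haN⟩, T, le_rfl, by simpa using hT'0, ha⟩
      obtain ⟨T, hT, hTc, hTr⟩ := exists_le_ncard_subProducts (f := N.subtype) hextract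
        (Nat.card N) (by rw [← hcard]; lia)
        (fun T hT hTc ↦ one_notMem_subProducts hfree hT (hcard ▸ hTc))
      have := ncard_subProducts_lt (one_notMem_subProducts (f := N.subtype) hfree hT
        (hcard ▸ hTc))
      lia
    · push Not at hquot
      have hXbot : X ≠ ⊥ := fun h ↦ hG
        (isMulCommutative_of_le_center hp hidx (h ▸ bot_le))
      by_cases hcen : Subgroup.center G = ⊥
      · have hXp := card_prime_of_center_eq_bot hp hidx hXbot hcen hquot
        have hcyc : IsCyclic (G ⧸ X) := isCyclic_of_prime_card (p := p) hidx
        let : CommGroup (G ⧸ X) := { (inferInstance : Group (G ⧸ X)) with mul_comm := mul_comm' }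
        let π : G →* G ⧸ X := QuotientGroup.mk' X
        have hπ : π.ker = X := QuotientGroup.ker_mk' X
        have : IsMulCommutative π.ker := by rw [hπ]; infer_instance
        rw [← hn]
        refine hasShortProductOne_of_frobenius (π := π) hp hXp hidx (by rw [hπ]) ?_ (by lia)
        intro z hz h hh hcomm
        rw [hπ] at hz hh
        have h1 := mem_center_of_commute hp hidx hh hz hcomm
        rwa [hcen] at h1
      · have hXc := card_eq_mul_card_center hp hidx hG hcen hquot
        have hV : Nat.card (G ⧸ Subgroup.center G) = p ^ 2 := by
          have h1 := Subgroup.card_mul_index X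
          have h2 := Subgroup.card_mul_index (Subgroup.center G)
          rw [hidx, ← h2, hXc] at h1
          refine Nat.eq_of_mul_eq_mul_left (Nat.card_pos (α := Subgroup.center G)) ?_
          exact h1.symm.trans (by ring)
        have hncyc : ¬ IsCyclic (G ⧸ Subgroup.center G) := fun h ↦
          hG (isMulCommutative_of_isCyclic_quotient_center_self G)
        have hexp : ∀ v : G ⧸ Subgroup.center G, v ^ p = 1 := fun v ↦ by
          rw [← (not_isCyclic_iff_exponent_eq_prime hp hV).1 hncyc]
          exact Monoid.pow_exponent_eq_one v
        have : IsMulCommutative (G ⧸ Subgroup.center G) :=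
          IsPGroup.isMulCommutative_of_card_eq_prime_sq hV
        let : CommGroup (G ⧸ Subgroup.center G) :=
          { (inferInstance : Group (G ⧸ Subgroup.center G)) with mul_comm := mul_comm' }
        rw [← hn, hXc]
        exact hasShortProductOne_of_ker_eq_center (π := QuotientGroup.mk' (Subgroup.center G))
          (QuotientGroup.mk'_surjective _) (QuotientGroup.ker_mk' _) hV hexp (by lia)

/-! ### The metacyclic group -/

lemma exists_isProductOneSubsequence_iff {G : Type*} [Group G] {S : List G} {l : ℕ} :
    (∃ T : List G, IsProductOneSubsequence T S ∧ T.length ≤ l) ↔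
      HasShortProductOne (S : Multiset G) l := by
  constructor
  · rintro ⟨T, ⟨hT0, hTS, L, hL, hL1⟩, hTl⟩
    exact ⟨T, hTS.subperm, by simpa using hT0, by simpa using hTl, L,
      Multiset.coe_eq_coe.2 hL, hL1⟩
  · rintro ⟨T, hTS, hT0, hTl, L, rfl, hL1⟩
    obtain ⟨M, hML, hMS⟩ := Multiset.coe_le.1 hTS
    refine ⟨M, ⟨?_, hMS, L, hML.symm, hL1⟩, by rw [hML.length_eq]; exact hTl⟩
    rintro rfl
    exact hT0 (by simpa using hML.symm.eq_nil)

namespace MetacyclicGroup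

variable (p n : ℕ) (g : ℤ)

/-- The generator `x` of order `n` of the metacyclic group. -/
def x : MetacyclicGroup p n g := PresentedGroup.of 0

/-- The generator `y` of order `p` of the metacyclic group. -/
def y : MetacyclicGroup p n g := PresentedGroup.of 1

lemma x_pow : x p n g ^ n = 1 := by
  have h := PresentedGroup.one_of_mem (rels := metacyclicRels p n g)
    (x := FreeGroup.of 0 ^ n) (by simp [metacyclicRels])
  rwa [map_pow] at h

lemma y_pow : y p n g ^ p = 1 := by
  have h := PresentedGroup.one_of_mem (rels := metacyclicRels p n g)
    (x := FreeGroup.of 1 ^ p) (by simp [metacyclicRels])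
  rwa [map_pow] at h

lemma x_zpow_mul_y : x p n g ^ g * y p n g = y p n g * x p n g := by
  have h := PresentedGroup.one_of_mem (rels := metacyclicRels p n g)
    (x := FreeGroup.of 0 ^ g * FreeGroup.of 1 * (FreeGroup.of 1 * FreeGroup.of 0)⁻¹)
    (by simp [metacyclicRels])
  simp only [map_mul, map_inv, map_zpow] at h
  exact mul_inv_eq_one.1 h

/-- The homomorphism to `ℤ / p` that kills `x` and maps `y` to the generator `1`. -/
def toZMod : MetacyclicGroup p n g →* Multiplicative (ZMod p) :=
  PresentedGroup.toGroup (f := ![1, Multiplicative.ofAdd 1]) (by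
    rintro r (rfl | rfl | rfl)
    · simp
    · simp [← ofAdd_nsmul]
    · simp)

lemma toZMod_x : toZMod p n g (x p n g) = 1 := PresentedGroup.toGroup.of _

lemma toZMod_y : toZMod p n g (y p n g) = Multiplicative.ofAdd 1 := PresentedGroup.toGroup.of _

/-- The action on `ℤ / n` by affine maps: `x` is the translation by `1` and `y` is the
multiplication by the unit `u`, which stands for the class of `g`. -/
def toPerm {p n : ℕ} {g : ℤ} (u : (ZMod n)ˣ) (hu : (u : ZMod n) = g) (hup : u ^ p = 1) :
    MetacyclicGroup p n g →* Equiv.Perm (ZMod n) :=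
  PresentedGroup.toGroup
    (f := ![Equiv.addRight 1, MulAction.toPermHom (ZMod n)ˣ (ZMod n) u]) (by
    rintro r (rfl | rfl | rfl)
    · simp [Equiv.nsmul_addRight]
    · rw [map_pow, FreeGroup.lift_apply_of]
      change MulAction.toPermHom (ZMod n)ˣ (ZMod n) u ^ p = 1
      rw [← map_pow, hup, map_one]
    · simp only [map_mul, map_inv, map_zpow, FreeGroup.lift_apply_of, Matrix.cons_val_zero,
        Matrix.cons_val_one, Matrix.cons_val_fin_one, Equiv.zsmul_addRight, mul_inv_eq_one]
      ext1 t
      simp [Units.smul_def, hu])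

variable {p n g}

lemma toPerm_x {u : (ZMod n)ˣ} (hu : (u : ZMod n) = g) (hup : u ^ p = 1) :
    toPerm u hu hup (x p n g) = Equiv.addRight 1 := PresentedGroup.toGroup.of _

lemma toPerm_y {u : (ZMod n)ˣ} (hu : (u : ZMod n) = g) (hup : u ^ p = 1) :
    toPerm u hu hup (y p n g) = MulAction.toPermHom (ZMod n)ˣ (ZMod n) u :=
  PresentedGroup.toGroup.of _

lemma exists_unit (hp : p ≠ 0) (hg : orderOf (g : ZMod n) = p) :
    ∃ u : (ZMod n)ˣ, (u : ZMod n) = g ∧ u ^ p = 1 := by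
  have hpow : (g : ZMod n) ^ p = 1 := hg ▸ pow_orderOf_eq_one _
  obtain ⟨u, hu⟩ := IsUnit.of_pow_eq_one hpow hp
  exact ⟨u, hu, Units.ext (by simpa [hu] using hpow)⟩

lemma orderOf_x (hp : p ≠ 0) (hg : orderOf (g : ZMod n) = p) : orderOf (x p n g) = n := by
  obtain ⟨u, hu, hup⟩ := exists_unit hp hg
  refine Nat.dvd_antisymm (orderOf_dvd_of_pow_eq_one (x_pow p n g)) ?_
  have h := congrArg (toPerm u hu hup) (pow_orderOf_eq_one (x p n g))
  rw [map_pow, toPerm_x, Equiv.nsmul_addRight, map_one] at h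
  have h0 := congrArg (fun σ : Equiv.Perm (ZMod n) ↦ σ 0) h
  simpa [ZMod.natCast_eq_zero_iff] using h0

lemma not_isMulCommutative (hp : 1 < p) (hg : orderOf (g : ZMod n) = p) :
    ¬ IsMulCommutative (MetacyclicGroup p n g) := by
  intro h
  obtain ⟨u, hu, hup⟩ := exists_unit (by lia) hg
  have h1 := congrArg (toPerm u hu hup) (mul_comm' (x p n g) (y p n g))
  rw [map_mul, map_mul, toPerm_x, toPerm_y] at h1
  have h0 := congrArg (fun σ : Equiv.Perm (ZMod n) ↦ σ 0) h1
  simp only [Equiv.Perm.coe_mul, Function.comp_apply, MulAction.toPermHom_apply,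
    MulAction.toPerm_apply, smul_zero, Equiv.coe_addRight, zero_add, Units.smul_def, smul_eq_mul,
    mul_one, hu] at h0
  rw [← h0, orderOf_one] at hg
  lia

lemma closure_x_y : Subgroup.closure {x p n g, y p n g} = ⊤ := by
  rw [← PresentedGroup.closure_range_of (metacyclicRels p n g)]
  congr 1
  ext a
  simp [x, y, Fin.exists_fin_two, eq_comm]

lemma normal_zpowers_x (hn : n ≠ 0) : (Subgroup.zpowers (x p n g)).Normal := by
  have hfin : Finite (Subgroup.zpowers (x p n g)) :=
    (isOfFinOrder_iff_pow_eq_one.2 ⟨n, by lia, x_pow p n g⟩).finite_zpowers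
  rw [← Subgroup.normalizer_eq_top_iff, ← top_le_iff, ← closure_x_y, Subgroup.closure_le]
  have hy : y p n g ∈ Subgroup.normalizer (Subgroup.zpowers (x p n g) : Set _) := by
    refine Subgroup.mem_normalizer_fintype ?_
    rintro _ ⟨k, rfl⟩
    refine ⟨g * k, ?_⟩
    have h : y p n g * x p n g * (y p n g)⁻¹ = x p n g ^ g :=
      mul_inv_eq_iff_eq_mul.2 (x_zpow_mul_y p n g).symm
    change x p n g ^ (g * k) = y p n g * x p n g ^ k * (y p n g)⁻¹
    rw [← conj_zpow, h, zpow_mul]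
  rintro a (rfl | rfl)
  · exact Subgroup.le_normalizer (Subgroup.mem_zpowers _)
  · exact hy

lemma index_zpowers_x (hn : n ≠ 0) :
    (Subgroup.zpowers (x p n g)).index = p := by
  have := normal_zpowers_x (p := p) (g := g) hn
  have hker : (toZMod p n g).ker = Subgroup.zpowers (x p n g) := by
    refine le_antisymm (fun w hw ↦ ?_) (by simpa using toZMod_x p n g)
    have htop : Subgroup.zpowers (x p n g) ⊔ Subgroup.zpowers (y p n g) = ⊤ := by
      rw [← top_le_iff, ← closure_x_y, Subgroup.closure_le]
      rintro a (rfl | rfl)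
      · exact Subgroup.mem_sup_left (Subgroup.mem_zpowers _)
      · exact Subgroup.mem_sup_right (Subgroup.mem_zpowers _)
    obtain ⟨h, hh, _, ⟨k, rfl⟩, rfl⟩ := Subgroup.mem_sup_of_normal_left.1
      (htop ▸ Subgroup.mem_top w)
    obtain ⟨i, rfl⟩ := hh
    simp only [MonoidHom.mem_ker, map_mul, map_zpow, toZMod_x, toZMod_y, one_zpow, one_mul,
      ← ofAdd_zsmul, ofAdd_eq_one, zsmul_eq_mul, mul_one, ZMod.intCast_zmod_eq_zero_iff_dvd] at hw
    obtain ⟨j, rfl⟩ := hw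
    simp [zpow_mul, y_pow]
  have hsurj : Function.Surjective (toZMod p n g) := by
    intro a
    refine ⟨y p n g ^ (a.toAdd.cast : ℤ), ?_⟩
    rw [map_zpow, toZMod_y, ← ofAdd_zsmul]
    simp
  rw [← hker, Subgroup.index_ker, MonoidHom.range_eq_top.2 hsurj, Subgroup.card_top]
  exact Nat.card_zmod p

/-- A product-one subsequence of `x, …, x, y, …, y`, with fewer than `p` terms `y`, has no term `y`,
as seen in `ℤ / p`, so it consists of at least `n` terms `x`. -/
lemma le_of_isProductOneSubsequence (hp : p ≠ 0) (hg : orderOf (g : ZMod n) = p) {a b : ℕ}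
    (hb : b < p) {T : List (MetacyclicGroup p n g)} (hT : IsProductOneSubsequence T
      (List.replicate a (x p n g) ++ List.replicate b (y p n g))) :
    n ≤ a ∧ n ≤ T.length := by
  obtain ⟨hT0, hTS, L, hL, hL1⟩ := hT
  obtain ⟨T₁, T₂, rfl, h1, h2⟩ := List.sublist_append_iff.1 hTS
  obtain ⟨i, hi, rfl⟩ := List.sublist_replicate_iff.1 h1
  obtain ⟨j, hj, rfl⟩ := List.sublist_replicate_iff.1 h2
  have hj0 : j = 0 := by
    have h3 := congrArg (toZMod p n g) hL1
    rw [map_list_prod, (hL.map _).prod_eq] at h3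
    simp only [List.map_append, List.map_replicate, toZMod_x, toZMod_y, List.prod_append,
      List.prod_replicate, one_pow, one_mul, map_one, ← ofAdd_nsmul, ofAdd_eq_one, nsmul_eq_mul,
      mul_one, ZMod.natCast_eq_zero_iff] at h3
    exact Nat.eq_zero_of_dvd_of_lt h3 (by lia)
  subst hj0
  simp only [List.replicate_zero, List.append_nil, List.length_replicate] at *
  rw [List.perm_replicate.1 hL, List.prod_replicate] at hL1
  have hdvd := orderOf_dvd_of_pow_eq_one hL1
  rw [orderOf_x hp hg] at hdvd
  have hi0 : 0 < i := Nat.pos_of_ne_zero fun h ↦ hT0 (by simp [h])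
  have := Nat.le_of_dvd hi0 hdvd
  lia

lemma exists_isProductOneSubsequence (hp : p.Prime) (hn : n ≠ 0)
    (hg : orderOf (g : ZMod n) = p) {S : List (MetacyclicGroup p n g)}
    (hS : S.length = n + p - 1) : ∃ T, IsProductOneSubsequence T S ∧ T.length ≤ n := by
  have := normal_zpowers_x (p := p) (g := g) hn
  have hidx := index_zpowers_x (p := p) (g := g) hn
  have hcard : Nat.card (Subgroup.zpowers (x p n g)) = n := by
    rw [Nat.card_zpowers, orderOf_x hp.ne_zero hg]
  have : Finite (MetacyclicGroup p n g) := by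
    refine Nat.finite_of_card_ne_zero ?_
    rw [← Subgroup.card_mul_index (Subgroup.zpowers (x p n g)), hidx, hcard]
    exact mul_ne_zero hn hp.ne_zero
  rw [exists_isProductOneSubsequence_iff]
  have h := hasShortProductOne_of_isCyclic_of_index_prime hp (Subgroup.zpowers (x p n g)) hidx
    (not_isMulCommutative hp.one_lt hg) (S := S) (by rw [hcard]; exact hS.ge)
  rwa [hcard] at h

lemma davenport_eq (hp : p.Prime) (hn : n ≠ 0) (hg : orderOf (g : ZMod n) = p) :
    davenport (MetacyclicGroup p n g) = n + p - 1 := by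
  have hp1 := hp.one_lt
  have hmem : n + p - 1 ∈ {m : ℕ | 0 < m ∧ ∀ S : List (MetacyclicGroup p n g), S.length = m →
      ∃ T, IsProductOneSubsequence T S} :=
    ⟨by lia, fun S hS ↦ (exists_isProductOneSubsequence hp hn hg hS).imp fun _ h ↦ h.1⟩
  refine le_antisymm (Nat.sInf_le hmem) (le_csInf ⟨_, hmem⟩ ?_)
  rintro m ⟨-, hm⟩
  by_contra! hlt
  obtain ⟨T, hT⟩ := hm (List.replicate (min m (n - 1)) (x p n g) ++
    List.replicate (m - (n - 1)) (y p n g)) (by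
      rw [List.length_append, List.length_replicate, List.length_replicate]; lia)
  have := (le_of_isProductOneSubsequence hp.ne_zero hg (by lia) hT).1
  lia

lemma fConstant_eq (hp : p.Prime) (hn : n ≠ 0) (hg : orderOf (g : ZMod n) = p) :
    fConstant (MetacyclicGroup p n g) = n := by
  have hp1 := hp.one_lt
  have hmem : n ∈ {m : ℕ | 0 < m ∧ ∀ S : List (MetacyclicGroup p n g),
      S.length = davenport (MetacyclicGroup p n g) →
      ∃ T, IsProductOneSubsequence T S ∧ T.length ≤ m} :=
    ⟨by lia, fun S hS ↦ exists_isProductOneSubsequence hp hn hg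
      (hS.trans (davenport_eq hp hn hg))⟩
  refine le_antisymm (Nat.sInf_le hmem) (le_csInf ⟨_, hmem⟩ ?_)
  rintro m ⟨-, hm⟩
  obtain ⟨T, hT, hTm⟩ := hm (List.replicate n (x p n g) ++ List.replicate (p - 1) (y p n g)) (by
    rw [List.length_append, List.length_replicate, List.length_replicate, davenport_eq hp hn hg]
    lia)
  exact (le_of_isProductOneSubsequence hp.ne_zero hg (by lia) hT).2.trans hTm

end MetacyclicGroup

end ProductOne

theorem theorem1p3 (p n : ℕ) (hp : p.Prime) (hn : 1 < n) (g : ℤ)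
    (hg : orderOf (g : ZMod n) = p) :
    ProductOne.davenport (ProductOne.MetacyclicGroup p n g) = n + p - 1 ∧
      ProductOne.fConstant (ProductOne.MetacyclicGroup p n g) = n :=
  ⟨ProductOne.MetacyclicGroup.davenport_eq hp (by lia) hg,
    ProductOne.MetacyclicGroup.fConstant_eq hp (by lia) hg⟩
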